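/- **Conventions.** A sequence $u_1,\dots,u_N\in\mathbb R^d$ is a tight frame of redundancy $N/d$ if $\|w\|_2^2=\sum_{j=1}^N\langle w,u_j\rangle^2$ for all $w\in\mathbb R^d$. An expansion $w=\sum_{j=1}^N a_ju_j$ with $\|a\|_\infty\le \frac{K}{\sqrt N}\|w\|_2$ is a Kashin representation of $w$ with level $K$. For a probability distribution $D$ on $\mathbb R^d$ supported on the Euclidean unit ball $B_2^d$, the oracle $\mathrm{STAT}_D(\tau)$ answers a query $\phi$ (a measurable function with values in $[-1,1]$ on $B_2^d$) with an arbitrary value $v$ such that $|v-\mathbb E_{w\sim D}[\phi(w)]|\le\tau$. The estimation complexity of an algorithm that uses $\mathrm{STAT}(\tau)$ is $1/\tau^2$. Such an algorithm solves $\ell_2$ mean estimation over $B_2^d$ with error $\varepsilon$ if, for every $D$ supported on $B_2^d$ and all admissible answers of the oracle, its output $\tilde w$ satisfies $\|\mathbb E_{w\sim D}[w]-\tilde w\|_2\le\varepsilon$. Running times are counted on a real RAM (unit-cost exact arithmetic, square roots and comparisons of reals; rational program constants; addition and truncated subtraction of indices). **Theorem.** There are a constant $K>0$, a polynomial $p$,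 and three real RAM programs, none of which depends on $d$ or $\varepsilon$, such that for every $d$, with $N=2d$, the following holds. 1. The first program gets $d$ and $\mathrm{poly}(d)$ fair coin flips, and computes vectors $u_1,\dots,u_N\in\mathbb R^d$. The second program gets $d$, a sequence of vectors $u_1,\dots,u_N\in\mathbb R^d$, an index $j\le N$ and a point $w\in\mathbb R^d$, and computes a number $\phi_j(w)$. The third program gets $d$, $u_1,\dots,u_N$ and numbers $v_1,\dots,v_N$, and computes a vector $\tilde w\in\mathbb R^d$. On all such inputs each program stops after at most $p(d)$ steps. 2. Call $u_1,\dots,u_N$ *good* if it is a tight frame (of redundancy $2$), $\phi_j(w)=\frac{\sqrt N}{K}\,a(w)_j$ for all $j$ and all $w\in\mathbb R^d$, where $a(w)$ is the coefficient vector of some Kashin representation of $w$ with level $K$ in this frame, and for every $\varepsilon>0$ the algorithm that asks the $2d$ queries $\phi_1,\dots,\phi_N$ to $\mathrm{STAT}(\varepsilon/K)$ and applies the third program to the answers solves $\ell_2$ mean estimation over $B_2^d$ with error $\varepsilon$. Then a good sequence exists, and the first program outputs a good sequence with probability at least $2/3$. In particular, $\ell_2$ mean estimation over $B_2^d$ with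 error $\varepsilon$ is solved efficiently with $2d$ queries to $\mathrm{STAT}(\Omega(\varepsilon))$; the estimation complexity is $K^2/\varepsilon^2=O(1/\varepsilon^2)$ and does not depend on $d$. -/

import Mathlib

open MeasureTheory

/-! ## Frames and Kashin representations -/

/-- `ℝ^d` with the Euclidean norm. -/
abbrev Vec (d : ℕ) : Type := EuclideanSpace ℝ (Fin d)

/-- `u_1, …, u_N` is a tight frame of `ℝ^d`: `‖w‖₂² = ∑_j ⟨w, u_j⟩²` for all `w`.
Its redundancy is `N / d`. -/
def IsTightFrame {d N : ℕ} (u : Fin N → Vec d) : Prop :=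
  ∀ w : Vec d, ‖w‖ ^ 2 = ∑ j, (inner ℝ w (u j)) ^ 2

/-- `w = ∑_j a_j u_j` is a Kashin representation of `w` with level `K`:
`‖a‖_∞ ≤ (K / √N) ‖w‖₂`. -/
def IsKashinRepresentation {d N : ℕ} (u : Fin N → Vec d) (K : ℝ) (w : Vec d)
    (a : Fin N → ℝ) : Prop :=
  w = ∑ j, a j • u j ∧ ∀ j, |a j| ≤ K / Real.sqrt N * ‖w‖

/-! ## Statistical queries and `ℓ₂` mean estimation -/

/-- An admissible query for distributions over the Euclidean unit ball: a (measurable) function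
with values in `[-1, 1]` on the ball. -/
def IsStatQuery {d : ℕ} (φ : Vec d → ℝ) : Prop :=
  Measurable φ ∧ ∀ w ∈ Metric.closedBall (0 : Vec d) 1, φ w ∈ Set.Icc (-1 : ℝ) 1

/-- `v` is an answer which the oracle `STAT_D(τ)` may return on the query `φ`. -/
def IsStatAnswer {d : ℕ} (D : Measure (Vec d)) (τ : ℝ) (φ : Vec d → ℝ) (v : ℝ) : Prop :=
  |v - ∫ w, φ w ∂D| ≤ τ

/-- The estimation complexity of an algorithm that uses `STAT(τ)`. -/
noncomputable def statEstimationComplexity (τ : ℝ) : ℝ := 1 / τ ^ 2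

/-- Asking the `m` queries `φ_1, …, φ_m` to `STAT(τ)` and applying `dec` to the answers solves
`ℓ₂` mean estimation over the unit ball of `ℝ^d` with error `ε`: for every distribution `D`
supported on the ball and all answers that `STAT_D(τ)` may return. -/
def SolvesL2MeanEstimation {d m : ℕ} (φ : Fin m → Vec d → ℝ) (dec : (Fin m → ℝ) → Vec d)
    (τ ε : ℝ) : Prop :=
  (∀ j, IsStatQuery (φ j)) ∧
  ∀ D : Measure (Vec d), IsProbabilityMeasure D →
    (∀ᵐ w ∂D, w ∈ Metric.closedBall (0 : Vec d) 1) →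
    ∀ v : Fin m → ℝ, (∀ j, IsStatAnswer D τ (φ j) (v j)) →
      ‖(∫ w, w ∂D) - dec v‖ ≤ ε

/-! ## A real random access machine with step count

Programs for a real RAM (unit-cost exact arithmetic, square roots and comparisons on reals; index
registers with addition and truncated subtraction only).  The only form of iteration is a loop
whose number of rounds is fixed on entry, so every program terminates. -/

/-- Memory: index registers holding natural numbers, and two-dimensional arrays of reals;
`cell a i j` is the entry `(i, j)` of array number `a`. -/
structure Store where
  idx : ℕ → ℕ
  cell : ℕ → ℕ → ℕ → ℝ

/-- Set index register `k` to `n`. -/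
def Store.setIdx (s : Store) (k n : ℕ) : Store where
  idx := Function.update s.idx k n
  cell := s.cell

/-- Set the entry `(i, j)` of array `a` to `x`. -/
noncomputable def Store.setCell (s : Store) (a i j : ℕ) (x : ℝ) : Store where
  idx := s.idx
  cell := fun a' i' j' => if a' = a ∧ i' = i ∧ j' = j then x else s.cell a' i' j'

/-- Index expressions. -/
inductive IExpr : Type
  | const (n : ℕ)
  | reg (k : ℕ)
  | add (e f : IExpr)
  | sub (e f : IExpr)

def IExpr.eval : IExpr → Store → ℕ
  | .const n, _ => n
  | .reg k, s => s.idx k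
  | .add e f, s => e.eval s + f.eval s
  | .sub e f, s => e.eval s - f.eval s

/-- The number of steps needed to evaluate an index expression. -/
def IExpr.cost : IExpr → ℕ
  | .const _ => 1
  | .reg _ => 1
  | .add e f => e.cost + f.cost + 1
  | .sub e f => e.cost + f.cost + 1

/-- Real expressions; the constants of a program are rational. -/
inductive RExpr : Type
  | const (q : ℚ)
  | ofIdx (e : IExpr)
  | cell (a : ℕ) (i j : IExpr)
  | add (x y : RExpr)
  | sub (x y : RExpr)
  | mul (x y : RExpr)
  | div (x y : RExpr)
  | sqrt (x : RExpr)

/-- Division by `0` and the square root of a negative number return `0`. -/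
noncomputable def RExpr.eval : RExpr → Store → ℝ
  | .const q, _ => (q : ℝ)
  | .ofIdx e, s => (e.eval s : ℝ)
  | .cell a i j, s => s.cell a (i.eval s) (j.eval s)
  | .add x y, s => x.eval s + y.eval s
  | .sub x y, s => x.eval s - y.eval s
  | .mul x y, s => x.eval s * y.eval s
  | .div x y, s => x.eval s / y.eval s
  | .sqrt x, s => Real.sqrt (x.eval s)

/-- The number of steps needed to evaluate a real expression. -/
def RExpr.cost : RExpr → ℕ
  | .const _ => 1
  | .ofIdx e => e.cost + 1
  | .cell _ i j => i.cost + j.cost + 1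
  | .add x y => x.cost + y.cost + 1
  | .sub x y => x.cost + y.cost + 1
  | .mul x y => x.cost + y.cost + 1
  | .div x y => x.cost + y.cost + 1
  | .sqrt x => x.cost + 1

/-- Programs.  `loop k e p` runs `p` with register `k` set to `0, 1, …, n - 1` successively, where
`n` is the value of `e` on entry. -/
inductive Prog : Type
  | skip
  | setIdx (k : ℕ) (e : IExpr)
  | setCell (a : ℕ) (i j : IExpr) (x : RExpr)
  | seq (p q : Prog)
  | ifIdxLe (e f : IExpr) (p q : Prog)
  | ifRealLe (x y : RExpr) (p q : Prog)
  | loop (k : ℕ) (e : IExpr) (p : Prog)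

/-- The store after `n` rounds of a loop with counter `k` and body `f`. -/
def loopState (f : Store → Store) (k : ℕ) (s : Store) : ℕ → Store
  | 0 => s
  | n + 1 => f ((loopState f k s n).setIdx k n)

/-- The store after a run of the program. -/
noncomputable def Prog.run : Prog → Store → Store
  | .skip, s => s
  | .setIdx k e, s => s.setIdx k (e.eval s)
  | .setCell a i j x, s => s.setCell a (i.eval s) (j.eval s) (x.eval s)
  | .seq p q, s => q.run (p.run s)
  | .ifIdxLe e f p q, s => if e.eval s ≤ f.eval s then p.run s else q.run s
  | .ifRealLe x y p q, s =>
      haveI := Classical.propDecidable (x.eval s ≤ y.eval s)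
      if x.eval s ≤ y.eval s then p.run s else q.run s
  | .loop k e p, s => loopState p.run k s (e.eval s)

/-- The number of steps of a run of the program. -/
noncomputable def Prog.steps : Prog → Store → ℕ
  | .skip, _ => 1
  | .setIdx _ e, _ => e.cost + 1
  | .setCell _ i j x, _ => i.cost + j.cost + x.cost + 1
  | .seq p q, s => p.steps s + q.steps (p.run s)
  | .ifIdxLe e f p q, s =>
      e.cost + f.cost + 1 + if e.eval s ≤ f.eval s then p.steps s else q.steps s
  | .ifRealLe x y p q, s =>
      haveI := Classical.propDecidable (x.eval s ≤ y.eval s)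
      x.cost + y.cost + 1 + if x.eval s ≤ y.eval s then p.steps s else q.steps s
  | .loop k e p, s =>
      e.cost + 1 + ∑ i ∈ Finset.range (e.eval s),
        (1 + p.steps ((loopState p.run k s i).setIdx k i))

/-! ## Nonadaptive statistical query algorithms on the real RAM -/

/-- The vector `v`, stored as row `0` of an array. -/
noncomputable def rowArray {n : ℕ} (v : Fin n → ℝ) : ℕ → ℕ → ℝ :=
  fun i j => if h : i = 0 ∧ j < n then v ⟨j, h.2⟩ else 0

/-- The vectors `u_1, …, u_N`, stored as the rows of an array. -/
noncomputable def frameArray {d N : ℕ} (u : Fin N → Vec d) : ℕ → ℕ → ℝ :=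
  fun j i => if h : j < N ∧ i < d then u ⟨j, h.1⟩ ⟨i, h.2⟩ else 0

/-- Register `0` contains `d` and register `1` contains `j`; arrays `0`, `1`, `2` contain `A₀`, `A₁`,
`A₂`; all the rest is `0`. -/
def inputStore (d j : ℕ) (A₀ A₁ A₂ : ℕ → ℕ → ℝ) : Store where
  idx
    | 0 => d
    | 1 => j
    | _ => 0
  cell
    | 0 => A₀
    | 1 => A₁
    | 2 => A₂
    | _ => 0

/-- A nonadaptive statistical query algorithm, uniform in the dimension `d`, which asks `2 d`
queries.  The three programs do not depend on `d`.
* `prepare` gets `d` and a sequence of coin flips and computes vectors `u_1, …, u_{2d}` of `ℝ^d`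
  (in array `1`).
* `query` gets `d`, `j`, the vectors `u_1, …, u_{2d}` and a point `w`, and computes the value at `w`
  of the `j`-th query (in entry `(0, 0)` of array `3`).
* `decode` gets `d`, the vectors `u_1, …, u_{2d}` and the `2 d` answers of the oracle, and computes
  the estimate of the mean (in row `0` of array `3`). -/
structure SQAlgorithm where
  prepare : Prog
  query : Prog
  decode : Prog

namespace SQAlgorithm

noncomputable def prepareInput (d : ℕ) {m : ℕ} (r : Fin m → Bool) : Store :=
  inputStore d 0 (rowArray fun i => if r i then 1 else 0) 0 0

noncomputable def queryInput {d : ℕ} (u : Fin (2 * d) → Vec d) (j : Fin (2 * d)) (w : Vec d) :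
    Store :=
  inputStore d j 0 (frameArray u) (rowArray fun i => w i)

noncomputable def decodeInput {d : ℕ} (u : Fin (2 * d) → Vec d) (v : Fin (2 * d) → ℝ) : Store :=
  inputStore d 0 0 (frameArray u) (rowArray v)

/-- The vectors `u_1, …, u_{2d}` computed from the coin flips `r`. -/
noncomputable def frame (A : SQAlgorithm) (d : ℕ) {m : ℕ} (r : Fin m → Bool) :
    Fin (2 * d) → Vec d :=
  fun j => WithLp.toLp 2 fun i => (A.prepare.run (prepareInput d r)).cell 1 j i

/-- The `j`-th query. -/
noncomputable def queryFun (A : SQAlgorithm) {d : ℕ} (u : Fin (2 * d) → Vec d)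
    (j : Fin (2 * d)) (w : Vec d) : ℝ :=
  (A.query.run (queryInput u j w)).cell 3 0 0

/-- The estimate computed from the answers `v`. -/
noncomputable def estimate (A : SQAlgorithm) {d : ℕ} (u : Fin (2 * d) → Vec d)
    (v : Fin (2 * d) → ℝ) : Vec d :=
  WithLp.toLp 2 fun i => (A.decode.run (decodeInput u v)).cell 3 0 i

/-- In dimension `d`, with `m` coin flips, each of the three programs makes at most `t` steps, on
all inputs. -/
def RunsInTime (A : SQAlgorithm) (d m t : ℕ) : Prop :=
  (∀ r : Fin m → Bool, A.prepare.steps (prepareInput d r) ≤ t) ∧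
  (∀ (u : Fin (2 * d) → Vec d) (j : Fin (2 * d)) (w : Vec d),
    A.query.steps (queryInput u j w) ≤ t) ∧
  (∀ (u : Fin (2 * d) → Vec d) (v : Fin (2 * d) → ℝ), A.decode.steps (decodeInput u v) ≤ t)

/-- The vectors `u_1, …, u_N`, `N = 2 d`, form a tight frame; the queries of the algorithm are the
normalized coefficients `(√N / K) a(w)_j` of Kashin representations of `w` with level `K` in this
frame; and with this frame the algorithm solves `ℓ₂` mean estimation over the unit ball with every
error `ε > 0` from the `2 d` answers of `STAT(ε / K)`. -/
def SucceedsWith (A : SQAlgorithm) (K : ℝ) {d : ℕ} (u : Fin (2 * d) → Vec d) : Prop :=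
  IsTightFrame u ∧
  (∃ a : Vec d → Fin (2 * d) → ℝ,
    (∀ w, IsKashinRepresentation u K w (a w)) ∧
    ∀ j w, A.queryFun u j w = Real.sqrt ((2 * d : ℕ) : ℝ) / K * a w j) ∧
  ∀ ε : ℝ, 0 < ε → SolvesL2MeanEstimation (A.queryFun u) (A.estimate u) (ε / K) ε

end SQAlgorithm

/-- The probability of an event under `m` independent fair coin flips. -/
noncomputable def coinProb (m : ℕ) (P : (Fin m → Bool) → Prop) : ℝ :=
  (Nat.card {r : Fin m → Bool // P r} : ℝ) / 2 ^ m

/-! A bounded error in each of the `N` coefficients is harmless when the coefficients are small. For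
a tight frame, `‖∑ c_j u_j‖ ≤ ‖c‖₂` (`IsTightFrame.norm_sum_smul_le`). The mean of `w` has the means
of the coefficients `a(w)_j` as coefficients. Each query is `a(w)_j` rescaled to `[-1, 1]` by the
factor `√N / K`, so accuracy `ε / K` in the answers is accuracy `ε / √N` in each coefficient and `ε`
in the `ℓ₂` norm.

Kashin representations are computed by iterated truncation. At level `√(D/N) ‖w‖` only `N/D` of the
frame coefficients of `w` can be truncated, so the residual is a combination of few frame vectors.
If such sparse combinations are shorter than their coefficient vectors by a factor `η < 1`
(`HasUncertaintyPrinciple`), the residual shrinks geometrically (`norm_truncStep_le`), the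
truncation levels sum to `O(‖w‖/√N)`, and a final residual of norm at most `‖w‖/√N` can be expanded
with its plain frame coefficients (`isKashinRepresentation_kashinCoef`).

The frame consists of the columns of a `d × 2d` matrix `Q` with orthonormal rows, obtained by
Gram–Schmidt from `[I | M]`, where `√d M` is the transpose of a random sign matrix `B`. The row
space is preserved and consists of the vectors `(p, Bp/√d)`. The uncertainty principle says that no
such vector has almost all its energy on a small set of coordinates. If `p` were concentrated on few
coordinates and `Bp` on few rows, `B` restricted to few columns and most rows would be nearly
singular. `IsWellConditioned` excludes this, and it holds with probability at least `2/3` by moment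
bounds for sums of signs, nets and a union bound (`card_not_isWellConditioned_le`). For `d < 1000`
the sparsity condition allows only the zero coefficient vector, so every coin sequence is good.

The programs are verified by loop invariants together with a frame condition `Store.Agree` on what a
program may change. They take polynomial time because the number of rounds of each loop is
determined by the unchanged register holding `d`. -/

/-! ### Nets of spheres -/

/-- Volume comparison: the balls of radius `ε / 2` about the points are disjoint and lie in the ball
of radius `1 + ε / 2`. -/
theorem card_le_of_separated_unitBall {E : Type*} [NormedAddCommGroup E] [NormedSpace ℝ E]
    [FiniteDimensional ℝ E] {ε : ℝ} (hε : 0 < ε) (s : Finset E) (hs : ∀ c ∈ s, ‖c‖ ≤ 1)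
    (h : ∀ c ∈ s, ∀ d ∈ s, c ≠ d → ε ≤ ‖c - d‖) :
    (s.card : ℝ) ≤ (1 + 2 / ε) ^ Module.finrank ℝ E := by
  borelize E
  let μ : Measure E := Measure.addHaar
  have hδ : 0 < ε / 2 := by positivity
  have hρ : 0 < 1 + ε / 2 := by positivity
  set A := ⋃ c ∈ s, Metric.ball (c : E) (ε / 2) with hA
  have D : Set.Pairwise (s : Set E)
      (Function.onFun Disjoint fun c => Metric.ball (c : E) (ε / 2)) := by
    rintro c hc d hd hcd
    apply Metric.ball_disjoint_ball
    rw [dist_eq_norm]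
    linarith [h c hc d hd hcd]
  have A_subset : A ⊆ Metric.ball (0 : E) (1 + ε / 2) := by
    refine Set.iUnion₂_subset fun x hx => Metric.ball_subset_ball' ?_
    rw [dist_zero_right]
    linarith [hs x hx]
  have I : (s.card : ENNReal) * ENNReal.ofReal ((ε / 2) ^ Module.finrank ℝ E) *
      μ (Metric.ball 0 1) ≤
      ENNReal.ofReal ((1 + ε / 2) ^ Module.finrank ℝ E) * μ (Metric.ball 0 1) :=
    calc
      _ = μ A := by
        rw [hA, measure_biUnion_finset D fun c _ => measurableSet_ball]
        simp only [μ.addHaar_ball_of_pos _ hδ]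
        simp only [Finset.sum_const, nsmul_eq_mul, mul_assoc]
      _ ≤ μ (Metric.ball (0 : E) (1 + ε / 2)) := measure_mono A_subset
      _ = _ := by simp only [μ.addHaar_ball_of_pos _ hρ]
  have J := (ENNReal.mul_le_mul_iff_left (Metric.measure_ball_pos μ (0 : E) zero_lt_one).ne'
    measure_ball_lt_top.ne).1 I
  have K := ENNReal.toReal_le_of_le_ofReal (pow_nonneg hρ.le _) J
  rw [ENNReal.toReal_mul, ENNReal.toReal_ofReal (by positivity), ENNReal.toReal_natCast] at K
  rw [← le_div_iff₀ (by positivity), ← div_pow] at K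
  refine K.trans_eq ?_
  congr 1
  field_simp
  ring

/-- Nets of the unit sphere, of exponential size. -/
theorem exists_sphere_net (E : Type*) [NormedAddCommGroup E] [NormedSpace ℝ E]
    [FiniteDimensional ℝ E] {ε : ℝ} (hε : 0 < ε) :
    ∃ s : Finset E, (s.card : ℝ) ≤ (1 + 2 / ε) ^ Module.finrank ℝ E ∧ (∀ c ∈ s, ‖c‖ = 1) ∧
      ∀ x : E, ‖x‖ = 1 → ∃ c ∈ s, ‖x - c‖ < ε := by
  classical
  -- The volume bound limits the size of `ε`-separated subsets of the sphere, so one of maximal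
  -- cardinality exists; a point at distance at least `ε` from all of it could be added.
  let P : ℕ → Prop := fun n => ∃ s : Finset E, s.card = n ∧ (∀ c ∈ s, ‖c‖ = 1) ∧
    ∀ c ∈ s, ∀ d ∈ s, c ≠ d → ε ≤ ‖c - d‖
  have hb : ∀ n, P n → n ≤ ⌊(1 + 2 / ε) ^ Module.finrank ℝ E⌋₊ := by
    rintro n ⟨s, rfl, h1, h2⟩
    exact Nat.le_floor (card_le_of_separated_unitBall hε s (fun c hc => (h1 c hc).le) h2)
  have h0 : P 0 := ⟨∅, by simp⟩
  obtain ⟨s, hs, h1, h2⟩ := Nat.findGreatest_spec (P := P)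
    (Nat.zero_le ⌊(1 + 2 / ε) ^ Module.finrank ℝ E⌋₊) h0
  refine ⟨s, card_le_of_separated_unitBall hε s (fun c hc => (h1 c hc).le) h2, h1, ?_⟩
  intro x hx
  by_contra! hcon
  have hxs : x ∉ s := fun hxs => by simpa using hε.trans_le (hcon x hxs)
  have hP : P (s.card + 1) := by
    refine ⟨insert x s, Finset.card_insert_of_notMem hxs, ?_, ?_⟩
    · intro c hc
      rcases Finset.mem_insert.1 hc with rfl | hc
      exacts [hx, h1 c hc]
    · intro c hc d hd hcd
      rcases Finset.mem_insert.1 hc with rfl | hc' <;> rcases Finset.mem_insert.1 hd with rfl | hd'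
      · exact absurd rfl hcd
      · exact hcon d hd'
      · rw [norm_sub_rev]; exact hcon c hc'
      · exact h2 c hc' d hd' hcd
  have := Nat.le_findGreatest (hb _ hP) hP
  omega

/-- Nets of the unit sphere of a coordinate subspace. -/
theorem exists_sparse_sphere_net {d : ℕ} (A : Finset (Fin d)) {ε : ℝ} (hε : 0 < ε) :
    ∃ s : Finset (Vec d), (s.card : ℝ) ≤ (1 + 2 / ε) ^ A.card ∧ (∀ c ∈ s, ‖c‖ = 1) ∧
      ∀ x : Vec d, ‖x‖ = 1 → (∀ i ∉ A, x i = 0) → ∃ c ∈ s, ‖x - c‖ < ε := by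
  classical
  -- Extension by zero is an isometry, so a net in dimension `A.card` can be transported; this makes
  -- the exponent `A.card` instead of `d`.
  let ext : EuclideanSpace ℝ A → Vec d :=
    fun y => WithLp.toLp 2 fun i => if h : i ∈ A then y ⟨i, h⟩ else 0
  have hnorm : ∀ y, ‖ext y‖ = ‖y‖ := by
    intro y
    rw [EuclideanSpace.norm_eq, EuclideanSpace.norm_eq]
    congr 1
    rw [← Finset.sum_subset (Finset.subset_univ A), ← Finset.sum_coe_sort A]
    · refine Finset.sum_congr rfl fun i _ => ?_
      simp [ext]
    · intro i _ hi
      simp [ext, hi]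
  have hsub : ∀ y z, ext (y - z) = ext y - ext z := by
    intro y z
    ext i
    by_cases h : i ∈ A <;> simp [ext, h]
  obtain ⟨s, hs, h1, h2⟩ := exists_sphere_net (EuclideanSpace ℝ A) hε
  refine ⟨s.image ext, ?_, ?_, ?_⟩
  · refine (Nat.cast_le.2 Finset.card_image_le).trans (hs.trans_eq ?_)
    simp
  · intro c hc
    obtain ⟨y, hy, rfl⟩ := Finset.mem_image.1 hc
    rw [hnorm, h1 y hy]
  · intro x hx hxA
    have hxe : x = ext (WithLp.toLp 2 fun i => x i) := by
      ext i
      by_cases h : i ∈ A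
      · simp [ext, h]
      · simp [ext, h, hxA i h]
    rw [hxe, hnorm] at hx
    obtain ⟨c, hc, hlt⟩ := h2 _ hx
    refine ⟨ext c, Finset.mem_image_of_mem _ hc, ?_⟩
    rw [hxe, ← hsub, hnorm]
    exact hlt

/-! ## Sums of random signs -/

/-- The sign of a coin flip. -/
def boolSign (b : Bool) : ℝ := if b then 1 else -1

def signSum {n : ℕ} (y : Fin n → ℝ) (b : Fin n → Bool) : ℝ := ∑ i, boolSign (b i) * y i

/-- Conditioning on the first sign; this drives the inductions for the second and fourth moments. -/
theorem sum_bool_cons {n : ℕ} (F : (Fin (n + 1) → Bool) → ℝ) :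
    ∑ b, F b = ∑ b : Fin n → Bool, (F (Fin.cons true b) + F (Fin.cons false b)) := by
  rw [← (Fin.consEquiv fun _ => Bool).sum_comp, Fintype.sum_prod_type_right]
  simp [Fin.consEquiv]

theorem signSum_cons {n : ℕ} (y : Fin (n + 1) → ℝ) (a : Bool) (b : Fin n → Bool) :
    signSum y (Fin.cons a b) = boolSign a * y 0 + signSum (fun i => y i.succ) b := by
  simp [signSum, Fin.sum_univ_succ]

theorem sum_signSum_sq {n : ℕ} (y : Fin n → ℝ) :
    ∑ b, signSum y b ^ 2 = 2 ^ n * ∑ i, y i ^ 2 := by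
  induction n with
  | zero => simp [signSum]
  | succ n ih =>
    have h : ∀ b : Fin n → Bool,
        signSum y (Fin.cons true b) ^ 2 + signSum y (Fin.cons false b) ^ 2 =
          2 * y 0 ^ 2 + 2 * signSum (fun i => y i.succ) b ^ 2 := by
      intro b
      rw [signSum_cons, signSum_cons]
      simp only [boolSign, if_true, Bool.false_eq_true, if_false]
      ring
    rw [sum_bool_cons, Finset.sum_congr rfl fun b _ => h b, Finset.sum_add_distrib,
      Finset.sum_const, ← Finset.mul_sum, ih, Fin.sum_univ_succ]
    simp
    ring

/-- Khintchine's inequality for the fourth moment. Odd powers of the first sign cancel; its fourth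
power contributes `y 0 ^ 4`, where the bound leaves room for `3 * y 0 ^ 4`. -/
theorem sum_signSum_pow_four_le {n : ℕ} (y : Fin n → ℝ) :
    ∑ b, signSum y b ^ 4 ≤ 2 ^ n * (3 * (∑ i, y i ^ 2) ^ 2) := by
  induction n with
  | zero => simp [signSum]
  | succ n ih =>
    have h : ∀ b : Fin n → Bool,
        signSum y (Fin.cons true b) ^ 4 + signSum y (Fin.cons false b) ^ 4 =
          2 * y 0 ^ 4 + 12 * y 0 ^ 2 * signSum (fun i => y i.succ) b ^ 2 +
            2 * signSum (fun i => y i.succ) b ^ 4 := by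
      intro b
      rw [signSum_cons, signSum_cons]
      simp only [boolSign, if_true, Bool.false_eq_true, if_false]
      ring
    rw [sum_bool_cons, Finset.sum_congr rfl fun b _ => h b, Finset.sum_add_distrib,
      Finset.sum_add_distrib, Finset.sum_const, ← Finset.mul_sum, ← Finset.mul_sum,
      sum_signSum_sq, Fin.sum_univ_succ]
    have h4 : 0 ≤ (2 : ℝ) ^ n * y 0 ^ 4 := by positivity
    have := ih fun i => y i.succ
    simp only [Finset.card_univ, Fintype.card_fun, Fintype.card_bool, Fintype.card_fin,
      nsmul_eq_mul]
    push_cast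
    rw [pow_succ (2 : ℝ) n]
    nlinarith

/-- Follows from `1 + x + x²/2 ≤ exp x`, since `(1 - x + x²/2)(1 + x + x²/2) = 1 + x⁴/4 ≥ 1`. -/
theorem exp_neg_le_quadratic {x : ℝ} (hx : 0 ≤ x) : Real.exp (-x) ≤ 1 - x + x ^ 2 / 2 := by
  have h := Real.quadratic_le_exp_of_nonneg hx
  have h1 : 0 < 1 - x + x ^ 2 / 2 := by nlinarith [sq_nonneg (x - 1)]
  rw [Real.exp_neg, inv_le_comm₀ (Real.exp_pos x) h1]
  refine le_trans ?_ h
  rw [inv_le_iff_one_le_mul₀ h1]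
  nlinarith [sq_nonneg (x ^ 2)]

theorem sum_exp_neg_signSum_sq_le {n : ℕ} (y : Fin n → ℝ) (hy : ∑ i, y i ^ 2 = 1) {l : ℝ}
    (hl : 0 ≤ l) :
    ∑ b, Real.exp (-(l * signSum y b ^ 2)) ≤ 2 ^ n * (1 - l + 3 / 2 * l ^ 2) := by
  have h : ∀ b, Real.exp (-(l * signSum y b ^ 2)) ≤
      1 - l * signSum y b ^ 2 + l ^ 2 / 2 * signSum y b ^ 4 := fun b =>
    (exp_neg_le_quadratic (by positivity)).trans_eq (by ring)
  refine (Finset.sum_le_sum fun b _ => h b).trans ?_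
  rw [Finset.sum_add_distrib, Finset.sum_sub_distrib, ← Finset.mul_sum, ← Finset.mul_sum,
    sum_signSum_sq, hy]
  have h4 := mul_le_mul_of_nonneg_left (sum_signSum_pow_four_le y)
    (show 0 ≤ l ^ 2 / 2 by positivity)
  rw [hy] at h4
  simp only [Finset.sum_const, Finset.card_univ, Fintype.card_fun, Fintype.card_bool,
      Fintype.card_fin, nsmul_eq_mul]
  push_cast
  linarith

theorem sum_pi_prod {ι κ : Type*} [Fintype ι] [DecidableEq ι] [Fintype κ]
    (f : ι → κ → ℝ) : ∑ B : ι → κ, ∏ k, f k (B k) = ∏ k, ∑ b, f k b := by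
  rw [Finset.prod_univ_sum, Fintype.piFinset_univ]

/-- Sign sums are subgaussian: the exponential moment factors over the independent signs, and `cosh
x ≤ exp (x²/2)`. -/
theorem sum_exp_signSum_le {n : ℕ} (y : Fin n → ℝ) (t : ℝ) :
    ∑ b, Real.exp (t * signSum y b) ≤ 2 ^ n * Real.exp (t ^ 2 / 2 * ∑ i, y i ^ 2) := by
  have h : ∀ b : Fin n → Bool, Real.exp (t * signSum y b) =
      ∏ i, Real.exp (t * (boolSign (b i) * y i)) := by
    intro b
    rw [← Real.exp_sum, ← Finset.mul_sum, signSum]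
  rw [Finset.sum_congr rfl fun b _ => h b,
    sum_pi_prod fun i (b : Bool) => Real.exp (t * (boolSign b * y i)), Finset.mul_sum,
    Real.exp_sum]
  have h2 : (2 : ℝ) ^ n = ∏ _i : Fin n, 2 := by simp
  rw [h2, ← Finset.prod_mul_distrib]
  refine Finset.prod_le_prod (fun i _ => Finset.sum_nonneg fun b _ => (Real.exp_pos _).le)
    fun i _ => ?_
  have hc := Real.cosh_le_exp_half_sq (t * y i)
  rw [Real.cosh_eq] at hc
  simp only [Fintype.sum_bool, boolSign, if_true, Bool.false_eq_true, if_false, one_mul, neg_mul,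
    mul_neg]
  rw [show t ^ 2 / 2 * y i ^ 2 = (t * y i) ^ 2 / 2 by ring]
  linarith

/-- Markov's inequality in counting form. Probabilities are cardinalities throughout, with `(2 ^ d)
^ d` as the total mass. -/
theorem card_filter_le_sum {α : Type*} [Fintype α] (P : α → Prop) [DecidablePred P] (f : α → ℝ)
    (h0 : ∀ a, 0 ≤ f a) (h1 : ∀ a, P a → 1 ≤ f a) :
    ((Finset.univ.filter P).card : ℝ) ≤ ∑ a, f a := by
  rw [Finset.card_filter, Nat.cast_sum]
  refine Finset.sum_le_sum fun a _ => ?_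
  by_cases h : P a <;> simp [h, h0, h1]

open Classical in
/-- Chernoff bound for the bilinear form of a random sign matrix. -/
theorem card_bilinear_large_le {d : ℕ} (y z : Fin d → ℝ) (hy : ∑ i, y i ^ 2 = 1)
    (hz : ∑ i, z i ^ 2 = 1) {t : ℝ} (ht : 0 ≤ t) :
    ((Finset.univ.filter fun B : Fin d → Fin d → Bool =>
      t ≤ ∑ k, z k * signSum y (B k)).card : ℝ) ≤ (2 ^ d) ^ d * Real.exp (-(t ^ 2 / 2)) := by
  -- The parameter `t` is optimal: the exponential moment is at most `exp (t²/2)` and the threshold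
  -- contributes `exp (-t²)`.
  refine (card_filter_le_sum _ (fun B => Real.exp (t * (∑ k, z k * signSum y (B k)) - t ^ 2))
    (fun B => (Real.exp_pos _).le) fun B hB => Real.one_le_exp (by nlinarith)).trans ?_
  have h : ∀ B : Fin d → Fin d → Bool,
      Real.exp (t * (∑ k, z k * signSum y (B k)) - t ^ 2) =
        Real.exp (-t ^ 2) * ∏ k, Real.exp ((t * z k) * signSum y (B k)) := by
    intro B
    rw [← Real.exp_sum, ← Real.exp_add, Finset.mul_sum]
    congr 1
    rw [sub_eq_neg_add]
    congr 1
    exact Finset.sum_congr rfl fun k _ => by ring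
  rw [Finset.sum_congr rfl fun B _ => h B, ← Finset.mul_sum,
    sum_pi_prod fun k b => Real.exp ((t * z k) * signSum y b)]
  have h2 : ∏ k, ∑ b, Real.exp ((t * z k) * signSum y b) ≤
      ∏ k : Fin d, (2 ^ d * Real.exp ((t * z k) ^ 2 / 2 * ∑ i, y i ^ 2)) :=
    Finset.prod_le_prod (fun i _ => Finset.sum_nonneg fun b _ => (Real.exp_pos _).le)
      fun k _ => sum_exp_signSum_le y _
  rw [Finset.prod_mul_distrib, ← Real.exp_sum, hy, Finset.prod_const, Finset.card_univ,
    Fintype.card_fin] at h2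
  have h3 : ∑ k, (t * z k) ^ 2 / 2 * 1 = t ^ 2 / 2 := by
    calc ∑ k, (t * z k) ^ 2 / 2 * 1 = t ^ 2 / 2 * ∑ k, z k ^ 2 := by
          rw [Finset.mul_sum]
          exact Finset.sum_congr rfl fun k _ => by ring
      _ = t ^ 2 / 2 := by rw [hz, mul_one]
  rw [h3] at h2
  refine (mul_le_mul_of_nonneg_left h2 (Real.exp_pos _).le).trans_eq ?_
  rw [mul_left_comm, ← Real.exp_add]
  congr 2
  ring

open Classical in
/-- Lower tail of the squared length of the image of a unit vector under a random sign matrix,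
restricted to most of the coordinates. -/
theorem card_sum_sq_small_le {d : ℕ} (y : Fin d → ℝ) (hy : ∑ i, y i ^ 2 = 1)
    (T : Finset (Fin d)) (hT : 9 / 10 * (d : ℝ) ≤ T.card) :
    ((Finset.univ.filter fun B : Fin d → Fin d → Bool =>
      ∑ k ∈ T, signSum y (B k) ^ 2 ≤ d / 4).card : ℝ) ≤
      (2 ^ d) ^ d * Real.exp (-(d / 16)) := by
  -- Exponential Markov with `l = 1/4`. Each row in `T` contributes `1 - 1/4 + 3/32 = 1 - 5/32 ≤ exp
  -- (-5/32)`, and `(5/32)(9/10) - 1/16 = 5/64` exceeds the required `1/16`.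
  let g : Fin d → (Fin d → Bool) → ℝ :=
    fun k b => if k ∈ T then Real.exp (-(1 / 4 * signSum y b ^ 2)) else 1
  refine (card_filter_le_sum _ (fun B => Real.exp (d / 16) * ∏ k, g k (B k))
    (fun B => ?_) fun B hB => ?_).trans ?_
  · refine mul_nonneg (Real.exp_pos _).le (Finset.prod_nonneg fun k _ => ?_)
    simp only [g]
    split_ifs <;> positivity
  · simp only [g]
    rw [Finset.prod_ite_mem, Finset.univ_inter, ← Real.exp_sum, ← Real.exp_add]
    refine Real.one_le_exp ?_
    rw [Finset.sum_neg_distrib, ← Finset.mul_sum]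
    linarith
  rw [← Finset.mul_sum, sum_pi_prod g]
  have h1 : ∏ k, ∑ b, g k b ≤ ∏ k : Fin d, (2 ^ d * if k ∈ T then Real.exp (-(5 / 32)) else 1) := by
    refine Finset.prod_le_prod (fun k _ => Finset.sum_nonneg fun b _ => ?_) fun k _ => ?_
    · simp only [g]
      split_ifs <;> positivity
    · simp only [g]
      split_ifs
      · refine (sum_exp_neg_signSum_sq_le y hy (by norm_num)).trans ?_
        gcongr
        refine le_trans ?_ (Real.add_one_le_exp _)
        norm_num
      · simp
  rw [Finset.prod_mul_distrib, Finset.prod_ite_mem, Finset.univ_inter, Finset.prod_const,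
    Finset.prod_const, Finset.card_univ, Fintype.card_fin, ← Real.exp_nat_mul] at h1
  refine (mul_le_mul_of_nonneg_left h1 (Real.exp_pos _).le).trans ?_
  rw [mul_left_comm, ← Real.exp_add]
  gcongr
  nlinarith

/-! ## Random sign matrices are well conditioned on sparse vectors -/

/-- The sign matrix with rows `B k`, with the entries in `S` of its values replaced by `0`. -/
noncomputable def signMap {d : ℕ} (B : Fin d → Fin d → Bool) (S : Finset (Fin d)) :
    Vec d →ₗ[ℝ] Vec d where
  toFun y := WithLp.toLp 2 fun k => if k ∈ S then 0 else signSum y (B k)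
  map_add' x y := by
    ext k
    by_cases h : k ∈ S
    · simp [h]
    · simp [h, signSum, mul_add, Finset.sum_add_distrib]
  map_smul' c y := by
    ext k
    by_cases h : k ∈ S
    · simp [h]
    · simp [h, signSum, Finset.mul_sum, mul_left_comm]

theorem norm_sq_signMap {d : ℕ} (B : Fin d → Fin d → Bool) (S : Finset (Fin d)) (y : Vec d) :
    ‖signMap B S y‖ ^ 2 = ∑ k ∈ Sᶜ, signSum y (B k) ^ 2 := by
  rw [EuclideanSpace.norm_sq_eq]
  simp only [signMap, LinearMap.coe_mk, AddHom.coe_mk, Real.norm_eq_abs, sq_abs, ite_pow, ne_eq,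
    OfNat.ofNat_ne_zero, not_false_eq_true, zero_pow]
  rw [← Finset.sum_filter_add_sum_filter_not Finset.univ (fun k => k ∈ S)]
  rw [Finset.sum_congr rfl (g := fun _ => (0 : ℝ)) fun k hk => if_pos (Finset.mem_filter.1 hk).2,
    Finset.sum_congr rfl (s₁ := Finset.univ.filter fun k => ¬ k ∈ S)
    (g := fun k => signSum y (B k) ^ 2) fun k hk => if_neg (Finset.mem_filter.1 hk).2]
  simp only [Finset.sum_const_zero, zero_add]
  congr 1
  ext k
  simp

theorem norm_signMap_le {d : ℕ} (B : Fin d → Fin d → Bool) (S : Finset (Fin d)) (y : Vec d) :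
    ‖signMap B S y‖ ≤ ‖signMap B ∅ y‖ := by
  rw [← sq_le_sq₀ (norm_nonneg _) (norm_nonneg _), norm_sq_signMap, norm_sq_signMap]
  exact Finset.sum_le_sum_of_subset_of_nonneg (Finset.compl_subset_compl.2 (Finset.empty_subset S))
    fun k _ _ => sq_nonneg _

theorem inner_signMap {d : ℕ} (B : Fin d → Fin d → Bool) (y z : Vec d) :
    inner ℝ z (signMap B ∅ y) = ∑ k, z k * signSum y (B k) := by
  simp [PiLp.inner_apply, signMap, mul_comm]

/-- The sign matrix has norm `O(√d)`, and it is bounded below by `Ω(√d)` on sparse vectors even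
after the removal of a few rows. -/
structure IsWellConditioned {d : ℕ} (B : Fin d → Fin d → Bool) : Prop where
  upper : ∀ y : Vec d, ‖signMap B ∅ y‖ ≤ 12 * Real.sqrt d * ‖y‖
  lower : ∀ A S : Finset (Fin d), 1000 * A.card ≤ d → 1000 * S.card ≤ d →
    ∀ y : Vec d, (∀ i ∉ A, y i = 0) → Real.sqrt d / 4 * ‖y‖ ≤ ‖signMap B S y‖

theorem norm_le_of_net {E : Type*} [NormedAddCommGroup E] [InnerProductSpace ℝ E] (s : Finset E)
    (hs : ∀ x : E, ‖x‖ = 1 → ∃ c ∈ s, ‖x - c‖ < 1 / 2) (v : E) {t : ℝ}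
    (ht : 0 ≤ t) (h : ∀ c ∈ s, inner ℝ c v ≤ t) : ‖v‖ ≤ 2 * t := by
  by_cases hv : v = 0
  · rw [hv, norm_zero]
    linarith
  have hv' : 0 < ‖v‖ := norm_pos_iff.2 hv
  obtain ⟨c, hc, hcv⟩ := hs (‖v‖⁻¹ • v) (by rw [norm_smul, norm_inv, norm_norm,
    inv_mul_cancel₀ hv'.ne'])
  have h1 : inner ℝ (‖v‖⁻¹ • v) v = ‖v‖ := by
    rw [real_inner_smul_left, real_inner_self_eq_norm_sq]
    field_simp
  have h2 : inner ℝ (‖v‖⁻¹ • v - c) v ≤ 1 / 2 * ‖v‖ :=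
    (real_inner_le_norm _ _).trans (by gcongr)
  rw [inner_sub_left, h1] at h2
  linarith [h c hc]

/-- Approximating a unit vector by the net gives `‖T‖ ≤ t + ‖T‖ / 2`; the last term is absorbed
because `‖T‖` is finite. -/
theorem opNorm_le_of_net {E F : Type*} [NormedAddCommGroup E] [NormedSpace ℝ E]
    [NormedAddCommGroup F] [NormedSpace ℝ F] (s : Finset E)
    (hs : ∀ x : E, ‖x‖ = 1 → ∃ c ∈ s, ‖x - c‖ < 1 / 2) (T : E →L[ℝ] F) {t : ℝ}
    (ht : 0 ≤ t) (h : ∀ c ∈ s, ‖T c‖ ≤ t) : ‖T‖ ≤ 2 * t := by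
  have : ‖T‖ ≤ t + ‖T‖ * (1 / 2) := by
    refine ContinuousLinearMap.opNorm_le_of_unit_norm (by positivity) fun x hx => ?_
    obtain ⟨c, hc, hcx⟩ := hs x hx
    calc ‖T x‖ = ‖T c + T (x - c)‖ := by rw [← map_add]; simp
      _ ≤ ‖T c‖ + ‖T (x - c)‖ := norm_add_le _ _
      _ ≤ t + ‖T‖ * (1 / 2) := by
        gcongr
        · exact h c hc
        · exact (T.le_opNorm _).trans (by gcongr)
  linarith

/-- Reduction to finitely many events. Two passes through the `1/2`-net, for the image and for the
argument, turn `3√d` into `12√d`. -/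
theorem isWellConditioned_of_net {d : ℕ} (B : Fin d → Fin d → Bool) (s : Finset (Vec d))
    (hs : ∀ x : Vec d, ‖x‖ = 1 → ∃ c ∈ s, ‖x - c‖ < 1 / 2)
    (hB : ∀ y ∈ s, ∀ z ∈ s, ∑ k, z k * signSum y (B k) < 3 * Real.sqrt d)
    (n : Finset (Fin d) → Finset (Vec d))
    (hn : ∀ A, ∀ x : Vec d, ‖x‖ = 1 → (∀ i ∉ A, x i = 0) → ∃ c ∈ n A, ‖x - c‖ < 1 / 48)
    (hBn : ∀ A S : Finset (Fin d), 1000 * A.card ≤ d → 1000 * S.card ≤ d → ∀ y ∈ n A,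
      (d : ℝ) / 4 < ∑ k ∈ Sᶜ, signSum y (B k) ^ 2) : IsWellConditioned B := by
  have hd := Real.sqrt_nonneg (d : ℝ)
  have upper : ∀ y : Vec d, ‖signMap B ∅ y‖ ≤ 12 * Real.sqrt d * ‖y‖ := by
    intro y
    have h1 : ∀ c ∈ s, ‖(signMap B ∅).toContinuousLinearMap c‖ ≤ 2 * (3 * Real.sqrt d) := by
      intro c hc
      refine norm_le_of_net s hs _ (by positivity) fun z hz => ?_
      rw [LinearMap.coe_toContinuousLinearMap', inner_signMap]
      exact (hB c hc z hz).le
    have h2 := opNorm_le_of_net s hs _ (by positivity) h1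
    refine ((signMap B ∅).toContinuousLinearMap.le_opNorm y).trans ?_
    gcongr
    linarith
  refine ⟨upper, fun A S hA hS y hy => ?_⟩
  by_cases hy0 : y = 0
  · simp [hy0]
  have hy' : 0 < ‖y‖ := norm_pos_iff.2 hy0
  obtain ⟨c, hc, hcy⟩ := hn A (‖y‖⁻¹ • y) (by rw [norm_smul, norm_inv, norm_norm,
    inv_mul_cancel₀ hy'.ne']) fun i hi => by simp [hy i hi]
  have h1 := hBn A S hA hS c hc
  rw [← norm_sq_signMap] at h1
  have h2 : Real.sqrt d / 2 ≤ ‖signMap B S c‖ := by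
    rw [← sq_le_sq₀ (by positivity) (norm_nonneg _), div_pow, Real.sq_sqrt (Nat.cast_nonneg d)]
    linarith
  -- The mesh `1/48` is chosen so that the norm bound `12√d` costs at most half of the lower bound
  -- `√d / 2` at the net point.
  have h3 : ‖signMap B S (‖y‖⁻¹ • y - c)‖ ≤ Real.sqrt d / 4 := by
    refine (norm_signMap_le _ _ _).trans ((upper _).trans ?_)
    have := mul_le_mul_of_nonneg_left hcy.le (show 0 ≤ 12 * Real.sqrt d by positivity)
    linarith
  have h4 : Real.sqrt d / 4 ≤ ‖signMap B S (‖y‖⁻¹ • y)‖ := by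
    have h5 : signMap B S c = signMap B S (‖y‖⁻¹ • y) - signMap B S (‖y‖⁻¹ • y - c) := by
      rw [← map_sub]
      simp
    have := norm_sub_le (signMap B S (‖y‖⁻¹ • y)) (signMap B S (‖y‖⁻¹ • y - c))
    rw [← h5] at this
    linarith
  rw [map_smul, norm_smul, norm_inv, norm_norm, ← div_eq_inv_mul, le_div_iff₀ hy'] at h4
  exact h4

theorem card_small_subsets_le (d : ℕ) :
    ((Finset.univ.filter fun A : Finset (Fin d) => 1000 * A.card ≤ d).card : ℝ) ≤
      Real.exp (d / 80) := by
  have hexp : (143 : ℝ) ≤ Real.exp 5 := by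
    have h := Real.exp_one_gt_d9
    have h1 : Real.exp 5 = Real.exp 1 ^ 5 := by rw [← Real.exp_nat_mul]; norm_num
    rw [h1]
    calc (143 : ℝ) ≤ 2.7 ^ 5 := by norm_num
      _ ≤ Real.exp 1 ^ 5 := by gcongr; linarith
  -- The weight is `exp ((d - 1000 * A.card) / 200)`, at least `1` on the sets counted. Its sum is
  -- `exp (d/200) (1 + exp (-5)) ^ d`, and `1/200 + 1/143 ≤ 1/80`.
  refine (card_filter_le_sum _ (fun A => Real.exp (d / 200) * Real.exp (-5) ^ A.card)
    (fun A => by positivity) fun A hA => ?_).trans ?_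
  · rw [← Real.exp_nat_mul, ← Real.exp_add]
    have : 1000 * (A.card : ℝ) ≤ d := mod_cast hA
    exact Real.one_le_exp (by linarith)
  rw [← Finset.mul_sum]
  have h := Fintype.sum_pow_mul_eq_add_pow (Fin d) (Real.exp (-5)) 1
  simp only [one_pow, mul_one, Fintype.card_fin] at h
  rw [h]
  have h1 : (Real.exp (-5) + 1) ^ d ≤ Real.exp (d * Real.exp (-5)) := by
    rw [Real.exp_nat_mul]
    gcongr
    exact Real.add_one_le_exp _
  have h2 : Real.exp (-5) ≤ 1 / 143 := by
    rw [Real.exp_neg, ← one_div]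
    gcongr
  refine (mul_le_mul_of_nonneg_left h1 (Real.exp_pos _).le).trans ?_
  rw [← Real.exp_add]
  gcongr
  have := mul_le_mul_of_nonneg_left h2 (Nat.cast_nonneg (α := ℝ) d)
  linarith [(Nat.cast_nonneg d : (0 : ℝ) ≤ d)]

open Classical in
theorem card_not_isWellConditioned_le {d : ℕ} (hd : 1000 ≤ d) :
    3 * ((Finset.univ.filter fun B : Fin d → Fin d → Bool => ¬ IsWellConditioned B).card : ℝ) ≤
      (2 ^ d) ^ d := by
  have hd' : (1000 : ℝ) ≤ d := mod_cast hd
  have hexp : (97 : ℝ) ≤ Real.exp 5 := by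
    have h := Real.exp_one_gt_d9
    have h1 : Real.exp 5 = Real.exp 1 ^ 5 := by rw [← Real.exp_nat_mul]; norm_num
    rw [h1]
    calc (97 : ℝ) ≤ 2.7 ^ 5 := by norm_num
      _ ≤ Real.exp 1 ^ 5 := by gcongr; linarith
  have hexp2 : (25 : ℝ) ≤ Real.exp 4 := by
    have h := Real.exp_one_gt_d9
    have h1 : Real.exp 4 = Real.exp 1 ^ 4 := by rw [← Real.exp_nat_mul]; norm_num
    rw [h1]
    calc (25 : ℝ) ≤ 2.7 ^ 4 := by norm_num
      _ ≤ Real.exp 1 ^ 4 := by gcongr; linarith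
  obtain ⟨s, hsc, hs1, hs⟩ := exists_sphere_net (Vec d) (ε := 1 / 2) (by norm_num)
  choose n hnc hn1 hn using fun A : Finset (Fin d) =>
    exists_sparse_sphere_net A (ε := 1 / 48) (by norm_num)
  have hsum : ∀ c : Vec d, ‖c‖ = 1 → ∑ i, c i ^ 2 = 1 := by
    intro c hc
    have := EuclideanSpace.norm_sq_eq c
    simpa [hc] using this.symm
  let P := Finset.univ.filter fun A : Finset (Fin d) => 1000 * A.card ≤ d
  let E₁ : Vec d × Vec d → Finset (Fin d → Fin d → Bool) := fun p =>
    Finset.univ.filter fun B => 3 * Real.sqrt d ≤ ∑ k, p.2 k * signSum p.1 (B k)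
  let E₂ : Finset (Fin d) → Finset (Fin d) → Vec d → Finset (Fin d → Fin d → Bool) :=
    fun A S y => Finset.univ.filter fun B => ∑ k ∈ Sᶜ, signSum y (B k) ^ 2 ≤ d / 4
  have hsub : (Finset.univ.filter fun B : Fin d → Fin d → Bool => ¬ IsWellConditioned B) ⊆
      -- Union bound: `E₁` collects violations of the norm bound at pairs of net points, `E₂` those
      -- of the lower bound at sparse net points, over all small `A` and `S`.
      (s ×ˢ s).biUnion E₁ ∪ P.biUnion fun A => P.biUnion fun S => (n A).biUnion (E₂ A S) := by
    intro B hB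
    by_contra hcon
    refine (Finset.mem_filter.1 hB).2 (isWellConditioned_of_net B s hs ?_ n hn ?_)
    · intro y hy z hz
      by_contra! h
      refine hcon (Finset.mem_union_left _ (Finset.mem_biUnion.2 ⟨(y, z), ?_, ?_⟩))
      · exact Finset.mk_mem_product hy hz
      · exact Finset.mem_filter.2 ⟨Finset.mem_univ _, h⟩
    · intro A S hA hS y hy
      by_contra! h
      refine hcon (Finset.mem_union_right _ (Finset.mem_biUnion.2 ⟨A, ?_, Finset.mem_biUnion.2
        ⟨S, ?_, Finset.mem_biUnion.2 ⟨y, hy, ?_⟩⟩⟩))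
      · exact Finset.mem_filter.2 ⟨Finset.mem_univ _, hA⟩
      · exact Finset.mem_filter.2 ⟨Finset.mem_univ _, hS⟩
      · exact Finset.mem_filter.2 ⟨Finset.mem_univ _, h⟩
  set W : ℝ := (2 ^ d) ^ d with hW
  have hWpos : 0 < W := by positivity
  have hP : (P.card : ℝ) ≤ Real.exp (d / 80) := card_small_subsets_le d
  have c1 : (((s ×ˢ s).biUnion E₁).card : ℝ) ≤ W * Real.exp (-(d / 2)) := by
    have h1 : ((s ×ˢ s).biUnion E₁).card ≤ ∑ p ∈ s ×ˢ s, (E₁ p).card := Finset.card_biUnion_le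
    have h2 : ∀ p ∈ s ×ˢ s, ((E₁ p).card : ℝ) ≤ W * Real.exp (-(9 * d / 2)) := by
      intro p hp
      rw [Finset.mem_product] at hp
      refine (card_bilinear_large_le p.1 p.2 (hsum _ (hs1 _ hp.1)) (hsum _ (hs1 _ hp.2))
        (by positivity)).trans_eq ?_
      rw [mul_pow, Real.sq_sqrt (Nat.cast_nonneg d)]
      norm_num [hW]
    -- The `25 ^ d` pairs of net points are outweighed by the Chernoff factor `exp (-9d/2)` at
    -- threshold `3√d`.
    have h3 : (s.card : ℝ) * s.card ≤ Real.exp (4 * d) := by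
      have h5 : (s.card : ℝ) ≤ 5 ^ d := by
        refine hsc.trans_eq ?_
        rw [finrank_euclideanSpace, Fintype.card_fin]
        norm_num
      calc (s.card : ℝ) * s.card ≤ 5 ^ d * 5 ^ d := by gcongr
        _ = 25 ^ d := by rw [← mul_pow]; norm_num
        _ ≤ Real.exp 4 ^ d := by gcongr
        _ = Real.exp (4 * d) := by rw [← Real.exp_nat_mul, mul_comm]
    calc (((s ×ˢ s).biUnion E₁).card : ℝ) ≤ ∑ p ∈ s ×ˢ s, ((E₁ p).card : ℝ) := by
          exact_mod_cast h1
      _ ≤ ∑ p ∈ s ×ˢ s, W * Real.exp (-(9 * d / 2)) := Finset.sum_le_sum h2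
      _ = (s.card : ℝ) * s.card * (W * Real.exp (-(9 * d / 2))) := by
          rw [Finset.sum_const, Finset.card_product, nsmul_eq_mul, Nat.cast_mul]
      _ ≤ Real.exp (4 * d) * (W * Real.exp (-(9 * d / 2))) := by gcongr
      _ = W * Real.exp (-(d / 2)) := by
          rw [mul_left_comm, ← Real.exp_add]
          congr 2
          ring
  have c2 : ((P.biUnion fun A => P.biUnion fun S => (n A).biUnion (E₂ A S)).card : ℝ) ≤
      W * Real.exp (-(d / 40)) := by
    have h1 : ∀ A ∈ P, ∀ S ∈ P, (((n A).biUnion (E₂ A S)).card : ℝ) ≤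
        Real.exp (d / 200) * (W * Real.exp (-(d / 16))) := by
      intro A hA S hS
      have hA' : 1000 * (A.card : ℝ) ≤ d := mod_cast (Finset.mem_filter.1 hA).2
      have hS' : 1000 * (S.card : ℝ) ≤ d := mod_cast (Finset.mem_filter.1 hS).2
      have h2 : ∀ y ∈ n A, ((E₂ A S y).card : ℝ) ≤ W * Real.exp (-(d / 16)) := by
        intro y hy
        refine card_sum_sq_small_le _ (hsum _ (hn1 A y hy)) Sᶜ ?_
        rw [Finset.card_compl, Fintype.card_fin, Nat.cast_sub (by simpa using S.card_le_univ)]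
        linarith
      have h3 : ((n A).biUnion (E₂ A S)).card ≤ ∑ y ∈ n A, (E₂ A S y).card :=
        Finset.card_biUnion_le
      calc (((n A).biUnion (E₂ A S)).card : ℝ) ≤ ∑ y ∈ n A, ((E₂ A S y).card : ℝ) := by
            exact_mod_cast h3
        _ ≤ ∑ y ∈ n A, W * Real.exp (-(d / 16)) := Finset.sum_le_sum h2
        _ = ((n A).card : ℝ) * (W * Real.exp (-(d / 16))) := by
            rw [Finset.sum_const, nsmul_eq_mul]
        _ ≤ Real.exp (d / 200) * (W * Real.exp (-(d / 16))) := by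
            gcongr
            calc ((n A).card : ℝ) ≤ 97 ^ A.card := (hnc A).trans_eq (by norm_num)
              _ ≤ Real.exp 5 ^ A.card := by gcongr
              _ = Real.exp (A.card * 5) := by rw [← Real.exp_nat_mul]
              _ ≤ Real.exp (d / 200) := by gcongr; linarith
    have h4 : ∀ A ∈ P, ((P.biUnion fun S => (n A).biUnion (E₂ A S)).card : ℝ) ≤
        Real.exp (d / 80) * (Real.exp (d / 200) * (W * Real.exp (-(d / 16)))) := by
      intro A hA
      have h3 : (P.biUnion fun S => (n A).biUnion (E₂ A S)).card ≤
        ∑ S ∈ P, ((n A).biUnion (E₂ A S)).card := Finset.card_biUnion_le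
      calc ((P.biUnion fun S => (n A).biUnion (E₂ A S)).card : ℝ)
          ≤ ∑ S ∈ P, (((n A).biUnion (E₂ A S)).card : ℝ) := by exact_mod_cast h3
        _ ≤ ∑ S ∈ P, Real.exp (d / 200) * (W * Real.exp (-(d / 16))) :=
            Finset.sum_le_sum (h1 A hA)
        _ ≤ _ := by
            rw [Finset.sum_const, nsmul_eq_mul]
            gcongr
    have h3 : (P.biUnion fun A => P.biUnion fun S => (n A).biUnion (E₂ A S)).card ≤
        ∑ A ∈ P, (P.biUnion fun S => (n A).biUnion (E₂ A S)).card := Finset.card_biUnion_le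
    calc ((P.biUnion fun A => P.biUnion fun S => (n A).biUnion (E₂ A S)).card : ℝ)
        ≤ ∑ A ∈ P, ((P.biUnion fun S => (n A).biUnion (E₂ A S)).card : ℝ) := by
          exact_mod_cast h3
      _ ≤ ∑ A ∈ P, Real.exp (d / 80) * (Real.exp (d / 200) * (W * Real.exp (-(d / 16)))) :=
          Finset.sum_le_sum h4
      _ ≤ Real.exp (d / 80) *
          (Real.exp (d / 80) * (Real.exp (d / 200) * (W * Real.exp (-(d / 16))))) := by
          rw [Finset.sum_const, nsmul_eq_mul]
          gcongr
      _ = W * Real.exp (d / 80 + (d / 80 + (d / 200 + -(d / 16)))) := by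
          rw [Real.exp_add, Real.exp_add, Real.exp_add]
          ring
      -- Two choices of small sets, one net, one tail: `1/80 + 1/80 + 1/200 - 1/16 = -13/400 ≤
      -- -1/40`.
      _ ≤ W * Real.exp (-(d / 40)) := by
          gcongr
          linarith
  -- This is where `1000 ≤ d` enters: `d / 40 ≥ 25`, so each of the two failure events has
  -- probability at most `1/6`.
  have hsmall : Real.exp (-25) ≤ 1 / 6 := by
    rw [Real.exp_neg, ← one_div]
    gcongr
    linarith [Real.add_one_le_exp (25 : ℝ)]
  have e1 : Real.exp (-((d : ℝ) / 2)) ≤ 1 / 6 :=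
    (Real.exp_le_exp.2 (by linarith)).trans hsmall
  have e2 : Real.exp (-((d : ℝ) / 40)) ≤ 1 / 6 :=
    (Real.exp_le_exp.2 (by linarith)).trans hsmall
  have hcard := (Finset.card_le_card hsub).trans (Finset.card_union_le _ _)
  have hcard' : ((Finset.univ.filter fun B : Fin d → Fin d → Bool =>
      ¬ IsWellConditioned B).card : ℝ) ≤ W * Real.exp (-(d / 2)) + W * Real.exp (-(d / 40)) :=
    (Nat.cast_le.2 hcard).trans (by push_cast; linarith)
  have := mul_le_mul_of_nonneg_left e1 hWpos.le
  have := mul_le_mul_of_nonneg_left e2 hWpos.le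
  linarith

/-! ## The uncertainty principle -/

/-- The uncertainty principle of Lyubarskii and Vershynin: sparse combinations of the vectors `u j`
are shorter than their coefficient vectors by the factor `η`. -/
def HasUncertaintyPrinciple {d N : ℕ} (u : Fin N → Vec d) (D : ℕ) (η : ℝ) : Prop :=
  ∀ x : Fin N → ℝ, D * (Finset.univ.filter fun j => x j ≠ 0).card ≤ N →
    ‖∑ j, x j • u j‖ ≤ η * Real.sqrt (∑ j, x j ^ 2)

def loIdx {d : ℕ} (i : Fin d) : Fin (2 * d) := ⟨i, by omega⟩

def hiIdx {d : ℕ} (i : Fin d) : Fin (2 * d) := ⟨d + i, by omega⟩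

theorem sum_lo_add_sum_hi {d : ℕ} (f : Fin (2 * d) → ℝ) :
    ∑ j, f j = ∑ i, f (loIdx i) + ∑ k, f (hiIdx k) := by
  rw [← (finCongr (two_mul d).symm).sum_comp, Fin.sum_univ_add]
  rfl

/-- A vector `(p, Bp/√d)` is controlled by its energy off `A` and `S`. With `a` the part of `p` on
`A`, the lower bound estimates `‖a‖` by the image of `a` off `S`; this image is that of `p`, up to
an error of at most `12√d ‖p - a‖`. -/
theorem IsWellConditioned.energy_le {d : ℕ} (hd : 0 < d) {B : Fin d → Fin d → Bool}
    (hB : IsWellConditioned B) (A S : Finset (Fin d)) (hA : 1000 * A.card ≤ d)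
    (hS : 1000 * S.card ≤ d) (v : Fin (2 * d) → ℝ)
    (hv : ∀ k, v (hiIdx k) = signSum (fun i => v (loIdx i)) (B k) / Real.sqrt d) :
    ∑ j, v j ^ 2 ≤
      689 ^ 2 * (∑ i ∈ Aᶜ, v (loIdx i) ^ 2 + ∑ k ∈ Sᶜ, v (hiIdx k) ^ 2) := by
  have hd' : (0 : ℝ) < d := mod_cast hd
  have hr : 0 < Real.sqrt d := Real.sqrt_pos.2 hd'
  have hrd : Real.sqrt d ^ 2 = d := Real.sq_sqrt hd'.le
  let p : Vec d := WithLp.toLp 2 fun i => v (loIdx i)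
  let a : Vec d := WithLp.toLp 2 fun i => if i ∈ A then v (loIdx i) else 0
  have hsum : ∀ S' : Finset (Fin d), ∑ k ∈ S'ᶜ, v (hiIdx k) ^ 2 = ‖signMap B S' p‖ ^ 2 / d := by
    intro S'
    rw [norm_sq_signMap, Finset.sum_div]
    exact Finset.sum_congr rfl fun k _ => by rw [hv k, div_pow, hrd]
  have hp : ‖p‖ ^ 2 = ∑ i, v (loIdx i) ^ 2 := by
    rw [EuclideanSpace.norm_sq_eq]
    simp [p]
  have hb : ‖p - a‖ ^ 2 = ∑ i ∈ Aᶜ, v (loIdx i) ^ 2 := by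
    rw [EuclideanSpace.norm_sq_eq, ← Finset.sum_add_sum_compl A]
    rw [Finset.sum_eq_zero fun i hi => by simp [p, a, hi], zero_add]
    refine Finset.sum_congr rfl fun i hi => ?_
    simp [p, a, Finset.mem_compl.1 hi]
  have h0 := hsum ∅
  rw [Finset.compl_empty] at h0
  rw [sum_lo_add_sum_hi, ← hp, ← hb, h0, hsum S]
  obtain ⟨g, hg⟩ : ∃ g, ‖signMap B S p‖ = Real.sqrt d * g :=
    ⟨‖signMap B S p‖ / Real.sqrt d, by field_simp⟩
  have hg0 : 0 ≤ g := by
    have := norm_nonneg (signMap B S p)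
    rw [hg] at this
    exact nonneg_of_mul_nonneg_right this hr
  have h1 : ‖signMap B ∅ p‖ ^ 2 / d ≤ 144 * ‖p‖ ^ 2 := by
    rw [div_le_iff₀ hd']
    have := pow_le_pow_left₀ (norm_nonneg _) (hB.upper p) 2
    rw [mul_pow, mul_pow, hrd] at this
    linarith
  have h2 := hB.lower A S hA hS a fun i hi => by simp [a, hi]
  have h3 : ‖signMap B S a‖ ≤ ‖signMap B S p‖ + ‖signMap B S (p - a)‖ := by
    have h : signMap B S a = signMap B S p - signMap B S (p - a) := by
      rw [← map_sub]
      simp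
    rw [h]
    exact norm_sub_le _ _
  have h4 := (norm_signMap_le B S (p - a)).trans (hB.upper (p - a))
  have h5 : ‖a‖ ≤ 4 * g + 48 * ‖p - a‖ := by
    refine le_of_mul_le_mul_left ?_ hr
    rw [hg] at h3
    linarith
  have h6 : ‖p‖ ≤ 4 * g + 49 * ‖p - a‖ := by
    have h : ‖p‖ ≤ ‖p - a‖ + ‖a‖ := by simpa using norm_add_le (p - a) a
    linarith
  have h7 := pow_le_pow_left₀ (norm_nonneg _) h6 2
  have h8 : ‖signMap B S p‖ ^ 2 / d = g ^ 2 := by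
    rw [hg, mul_pow, hrd]
    field_simp
  rw [h8]
  -- The total energy is at most `145 ‖p‖²`, and Cauchy–Schwarz gives `(4g + 49b)² ≤ 2417 (g² + b²)`
  -- with `b = ‖p - a‖`; the product `145 * 2417` is below `689² = (13 * 53)²`.
  nlinarith [sq_nonneg (49 * g - 4 * ‖p - a‖), sq_nonneg g, sq_nonneg (‖p - a‖)]

theorem isTightFrame_of_orthonormal_rows {d N : ℕ} (u : Fin N → Vec d)
    (h : ∀ l l' : Fin d, ∑ j, u j l * u j l' = if l = l' then 1 else 0) : IsTightFrame u := by
  intro w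
  have h1 : ∀ j, inner ℝ w (u j) ^ 2 = ∑ l, ∑ l', w l * w l' * (u j l * u j l') := by
    intro j
    have : inner ℝ w (u j) = ∑ l, w l * u j l := by simp [PiLp.inner_apply, mul_comm]
    rw [this, sq, Finset.sum_mul_sum]
    exact Finset.sum_congr rfl fun l _ => Finset.sum_congr rfl fun l' _ => by ring
  rw [EuclideanSpace.norm_sq_eq, Finset.sum_congr rfl fun j _ => h1 j, Finset.sum_comm]
  refine Finset.sum_congr rfl fun l _ => ?_
  rw [Finset.sum_comm]
  simp only [← Finset.mul_sum, h]
  simp [sq]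

/-- Duality: `y = ∑ x_j u_j` pairs `x` with the coefficient vector `v` of `y`, which lies in the row
space. Only the energy of `v` on the support of `x` enters, and that is at most a fraction `1 -
1/689²` of the whole. -/
theorem hasUncertaintyPrinciple_of_rows {d : ℕ} (B : Fin d → Fin d → Bool)
    (hB : d < 1000 ∨ IsWellConditioned B) (u : Fin (2 * d) → Vec d)
    (horth : ∀ l l' : Fin d, ∑ j, u j l * u j l' = if l = l' then 1 else 0)
    (hrow : ∀ l k, u (hiIdx k) l = signSum (fun i => u (loIdx i) l) (B k) / Real.sqrt d) :
    HasUncertaintyPrinciple u 2000 (1 - 1 / (2 * 689 ^ 2)) := by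
  intro x hx
  set Ω := Finset.univ.filter fun j => x j ≠ 0 with hΩ
  -- Here `2000 * Ω.card ≤ 2 * d < 2000` forces an empty support, and `B` plays no role.
  rcases lt_or_ge d 1000 with hd | hd
  · have hΩ0 : Ω = ∅ := Finset.card_eq_zero.1 (by omega)
    have hx0 : ∀ j, x j = 0 := by
      intro j
      by_contra h
      have : j ∈ Ω := by simp [hΩ, h]
      simp [hΩ0] at this
    simp [hx0]
  have hB' := hB.resolve_left (by omega)
  set y : Vec d := ∑ j, x j • u j with hy
  let v : Fin (2 * d) → ℝ := fun j => inner ℝ y (u j)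
  have hv1 : ∑ j, v j ^ 2 = ‖y‖ ^ 2 := (isTightFrame_of_orthonormal_rows u horth y).symm
  have hv2 : ∑ j, x j * v j = ‖y‖ ^ 2 := by
    rw [← real_inner_self_eq_norm_sq]
    conv_rhs => rw [hy, inner_sum, ← hy]
    simp only [real_inner_smul_right, v]
  -- The linear relation satisfied by every row passes to `v`, a linear combination of the rows.
  have hv3 : ∀ k, v (hiIdx k) = signSum (fun i => v (loIdx i)) (B k) / Real.sqrt d := by
    intro k
    have hin : ∀ j, v j = ∑ l, y l * u j l := fun j => by
      simp [v, PiLp.inner_apply, mul_comm]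
    simp only [hin, hrow, signSum, Finset.mul_sum, Finset.sum_div]
    rw [Finset.sum_comm]
    exact Finset.sum_congr rfl fun i _ => Finset.sum_congr rfl fun l _ => by ring
  let A : Finset (Fin d) := Finset.univ.filter fun i => loIdx i ∈ Ω
  let S : Finset (Fin d) := Finset.univ.filter fun k => hiIdx k ∈ Ω
  have hA : A.card ≤ Ω.card := by
    refine Finset.card_le_card_of_injOn loIdx (fun i hi => (Finset.mem_filter.1 hi).2) ?_
    intro i _ j _ hij
    simpa [loIdx, Fin.ext_iff] using hij
  have hS : S.card ≤ Ω.card := by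
    refine Finset.card_le_card_of_injOn hiIdx (fun i hi => (Finset.mem_filter.1 hi).2) ?_
    intro i _ j _ hij
    simpa [hiIdx, Fin.ext_iff] using hij
  have hE := hB'.energy_le (by omega) A S (by omega) (by omega) v hv3
  have hcompl : ∑ i ∈ Aᶜ, v (loIdx i) ^ 2 + ∑ k ∈ Sᶜ, v (hiIdx k) ^ 2 =
      ∑ j ∈ Ωᶜ, v j ^ 2 := by
    have h1 : ∑ j ∈ Ωᶜ, v j ^ 2 = ∑ j, if j ∈ Ω then 0 else v j ^ 2 := by
      rw [← Finset.sum_add_sum_compl Ω fun j => if j ∈ Ω then 0 else v j ^ 2]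
      rw [Finset.sum_eq_zero fun j hj => if_pos hj, zero_add]
      exact Finset.sum_congr rfl fun j hj => (if_neg (Finset.mem_compl.1 hj)).symm
    rw [h1, sum_lo_add_sum_hi]
    congr 1
    · rw [← Finset.sum_add_sum_compl A fun i => if loIdx i ∈ Ω then 0 else v (loIdx i) ^ 2]
      rw [Finset.sum_eq_zero fun i hi => if_pos (Finset.mem_filter.1 hi).2, zero_add]
      exact Finset.sum_congr rfl fun i hi => (if_neg fun h =>
        Finset.mem_compl.1 hi (Finset.mem_filter.2 ⟨Finset.mem_univ _, h⟩)).symm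
    · rw [← Finset.sum_add_sum_compl S fun i => if hiIdx i ∈ Ω then 0 else v (hiIdx i) ^ 2]
      rw [Finset.sum_eq_zero fun i hi => if_pos (Finset.mem_filter.1 hi).2, zero_add]
      exact Finset.sum_congr rfl fun i hi => (if_neg fun h =>
        Finset.mem_compl.1 hi (Finset.mem_filter.2 ⟨Finset.mem_univ _, h⟩)).symm
  rw [hcompl, hv1] at hE
  have hsplit := Finset.sum_add_sum_compl Ω fun j => v j ^ 2
  rw [hv1] at hsplit
  have hcs : (‖y‖ ^ 2) ^ 2 ≤ (∑ j, x j ^ 2) * ∑ j ∈ Ω, v j ^ 2 := by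
    have h1 : ∑ j, x j * v j = ∑ j ∈ Ω, x j * v j := by
      refine (Finset.sum_subset (Finset.subset_univ Ω) fun j _ hj => ?_).symm
      have : x j = 0 := by
        by_contra h
        exact hj (by simp [hΩ, h])
      simp [this]
    rw [← hv2, h1]
    refine (Finset.sum_mul_sq_le_sq_mul_sq Ω x v).trans ?_
    gcongr
    exact Finset.subset_univ Ω
  have hX : 0 ≤ ∑ j, x j ^ 2 := Finset.sum_nonneg fun j _ => sq_nonneg _
  have hmain : ‖y‖ ^ 2 ≤ (1 - 1 / 689 ^ 2) * ∑ j, x j ^ 2 := by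
    by_cases hy0 : ‖y‖ ^ 2 = 0
    · rw [hy0]
      exact mul_nonneg (by norm_num) hX
    have hpos : 0 < ‖y‖ ^ 2 := lt_of_le_of_ne (sq_nonneg _) (Ne.symm hy0)
    refine le_of_mul_le_mul_right ?_ hpos
    have h1 : ∑ j ∈ Ω, v j ^ 2 ≤ (1 - 1 / 689 ^ 2) * ‖y‖ ^ 2 := by linarith
    have := mul_le_mul_of_nonneg_left h1 hX
    linarith
  -- Taking the root: `1 - δ ≤ (1 - δ/2)²` with `δ = 1/689²`, which explains the factor `2` in `η`.
  refine le_of_sq_le_sq ?_ (mul_nonneg (by norm_num) (Real.sqrt_nonneg _))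
  rw [mul_pow, Real.sq_sqrt hX]
  refine hmain.trans ?_
  gcongr
  norm_num

/-! ## Tight frames -/

theorem IsTightFrame.inner_eq {d N : ℕ} {u : Fin N → Vec d} (hu : IsTightFrame u) (x y : Vec d) :
    inner ℝ x y = ∑ j, inner ℝ x (u j) * inner ℝ y (u j) := by
  have h := hu (x + y)
  simp only [inner_add_left, add_sq, Finset.sum_add_distrib] at h
  rw [norm_add_sq_real, hu x, hu y] at h
  have h2 : ∑ j, 2 * inner ℝ x (u j) * inner ℝ y (u j) =
      2 * ∑ j, inner ℝ x (u j) * inner ℝ y (u j) := by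
    rw [Finset.mul_sum]
    exact Finset.sum_congr rfl fun j _ => by ring
  linarith

theorem IsTightFrame.sum_inner_smul {d N : ℕ} {u : Fin N → Vec d} (hu : IsTightFrame u)
    (x : Vec d) : ∑ j, inner ℝ x (u j) • u j = x := by
  refine ext_inner_right ℝ fun y => ?_
  rw [hu.inner_eq x y, sum_inner]
  exact Finset.sum_congr rfl fun j _ => by rw [real_inner_smul_left, real_inner_comm y]

theorem IsTightFrame.abs_inner_le {d N : ℕ} {u : Fin N → Vec d} (hu : IsTightFrame u)
    (x : Vec d) (j : Fin N) : |inner ℝ x (u j)| ≤ ‖x‖ := by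
  refine abs_le_of_sq_le_sq ?_ (norm_nonneg x)
  rw [hu x]
  exact Finset.single_le_sum (f := fun j => inner ℝ x (u j) ^ 2) (fun j _ => sq_nonneg _)
    (Finset.mem_univ j)

/-- The synthesis map is the adjoint of the isometry `x ↦ (⟨x, u_j⟩)_j`, hence a contraction. -/
theorem IsTightFrame.norm_sum_smul_le {d N : ℕ} {u : Fin N → Vec d} (hu : IsTightFrame u)
    (c : Fin N → ℝ) : ‖∑ j, c j • u j‖ ≤ Real.sqrt (∑ j, c j ^ 2) := by
  set y := ∑ j, c j • u j with hy
  have h1 : ‖y‖ ^ 2 = ∑ j, c j * inner ℝ y (u j) := by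
    rw [← real_inner_self_eq_norm_sq]
    nth_rewrite 2 [hy]
    rw [inner_sum]
    simp only [real_inner_smul_right]
  have h2 := Finset.sum_mul_sq_le_sq_mul_sq Finset.univ c fun j => inner ℝ y (u j)
  rw [← h1, ← hu y] at h2
  refine Real.le_sqrt_of_sq_le ?_
  by_cases hy0 : ‖y‖ ^ 2 = 0
  · rw [hy0]
    exact Finset.sum_nonneg fun j _ => sq_nonneg _
  have hpos : 0 < ‖y‖ ^ 2 := lt_of_le_of_ne (sq_nonneg _) (Ne.symm hy0)
  exact le_of_mul_le_mul_right (by linarith) hpos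

/-! ## The algorithm of Lyubarskii and Vershynin -/

/-- Truncation of `b` to `[-M, M]`. -/
noncomputable def clip (M b : ℝ) : ℝ := (|b + M| - |b - M|) / 2

theorem abs_clip_le {M : ℝ} (hM : 0 ≤ M) (b : ℝ) : |clip M b| ≤ M := by
  rw [clip, abs_div, abs_two, div_le_iff₀ two_pos]
  refine (abs_abs_sub_abs_le _ _).trans ?_
  rw [show b + M - (b - M) = 2 * M by ring, abs_of_nonneg (by positivity)]
  linarith

theorem clip_eq_self {M b : ℝ} (h : |b| ≤ M) : clip M b = b := by
  obtain ⟨h1, h2⟩ := abs_le.1 h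
  rw [clip, abs_of_nonneg (by linarith), abs_of_nonpos (by linarith)]
  ring

theorem abs_sub_clip_le {M : ℝ} (hM : 0 ≤ M) (b : ℝ) : |b - clip M b| ≤ |b| := by
  rcases le_or_gt |b| M with h | h
  · rw [clip_eq_self h, sub_self, abs_zero]
    exact abs_nonneg b
  · rw [clip]
    rcases lt_abs.1 h with h | h
    · rw [abs_of_nonneg (show 0 ≤ b + M by linarith), abs_of_nonneg (show 0 ≤ b - M by linarith),
        abs_of_nonneg (show 0 ≤ b by linarith), abs_of_nonneg (by linarith)]
      linarith
    · rw [abs_of_nonpos (show b + M ≤ 0 by linarith), abs_of_nonpos (show b - M ≤ 0 by linarith),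
        abs_of_nonpos (show b ≤ 0 by linarith), abs_of_nonpos (by linarith)]
      linarith

section

variable {d N : ℕ} (D : ℕ) (u : Fin N → Vec d)

/-- The truncation level for the coefficients of `w`. -/
noncomputable def truncLevel (N D : ℕ) {d : ℕ} (w : Vec d) : ℝ :=
  Real.sqrt (D * (∑ l, w l * w l) / N)

/-- The truncated frame coefficients of `w`. -/
noncomputable def truncCoef (w : Vec d) (j : Fin N) : ℝ :=
  clip (truncLevel N D w) (∑ l, w l * u j l)

/-- One round: subtract the expansion with the truncated coefficients. -/
noncomputable def truncStep (w : Vec d) : Vec d := w - ∑ j, truncCoef D u w j • u j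

/-- The residual after `n` rounds. -/
noncomputable def frameResidual (w : Vec d) (n : ℕ) : Vec d := (truncStep D u)^[n] w

/-- The coefficients accumulated in `n` rounds, and the frame coefficients of the residual. -/
noncomputable def kashinCoef (n : ℕ) (w : Vec d) (j : Fin N) : ℝ :=
  ∑ s ∈ Finset.range n, truncCoef D u (frameResidual D u w s) j + ∑ l, frameResidual D u w n l * u j l

end

section

variable {d N D : ℕ} {u : Fin N → Vec d}

theorem inner_eq_sum_mul (w v : Vec d) : inner ℝ w v = ∑ l, w l * v l := by
  simp [PiLp.inner_apply, mul_comm]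

theorem truncLevel_eq (w : Vec d) : truncLevel N D w = Real.sqrt D / Real.sqrt N * ‖w‖ := by
  rw [truncLevel, ← inner_eq_sum_mul, real_inner_self_eq_norm_sq,
    Real.sqrt_div (by positivity), Real.sqrt_mul (Nat.cast_nonneg D), Real.sqrt_sq (norm_nonneg w)]
  ring

theorem frameResidual_succ (w : Vec d) (n : ℕ) :
    frameResidual D u w (n + 1) = truncStep D u (frameResidual D u w n) := by
  rw [frameResidual, frameResidual, Function.iterate_succ_apply']

/-- The new residual is the expansion with the truncated-off parts of the frame coefficients. They
are nonzero at no more than `N / D` places, by Chebyshev and the tight frame identity, so the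
uncertainty principle applies. -/
theorem norm_truncStep_le (hN : 0 < N) (hD : 0 < D) {η : ℝ} (hη : 0 ≤ η) (hu : IsTightFrame u)
    (hup : HasUncertaintyPrinciple u D η) (w : Vec d) : ‖truncStep D u w‖ ≤ η * ‖w‖ := by
  have hM : 0 ≤ truncLevel N D w := Real.sqrt_nonneg _
  have hN' : (0 : ℝ) < N := mod_cast hN
  have hD' : (0 : ℝ) < D := mod_cast hD
  have h1 : truncStep D u w = ∑ j, (inner ℝ w (u j) - truncCoef D u w j) • u j := by
    simp only [sub_smul, Finset.sum_sub_distrib, hu.sum_inner_smul, truncStep]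
  rw [h1]
  refine (hup _ ?_).trans ?_
  · set Ω := Finset.univ.filter fun j => inner ℝ w (u j) - truncCoef D u w j ≠ 0 with hΩ
    have h2 : ∀ j ∈ Ω, truncLevel N D w ≤ |inner ℝ w (u j)| := by
      intro j hj
      by_contra! h
      refine (Finset.mem_filter.1 hj).2 ?_
      rw [truncCoef, ← inner_eq_sum_mul, clip_eq_self h.le, sub_self]
    have hlev : truncLevel N D w ^ 2 = D * ‖w‖ ^ 2 / N := by
      rw [truncLevel_eq, mul_pow, div_pow, Real.sq_sqrt hD'.le, Real.sq_sqrt hN'.le]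
      ring
    have h3 : Ω.card * truncLevel N D w ^ 2 ≤ ‖w‖ ^ 2 := by
      rw [hu w, ← nsmul_eq_mul, ← Finset.sum_const]
      refine (Finset.sum_le_sum fun j hj => ?_).trans
        (Finset.sum_le_sum_of_subset_of_nonneg (Finset.subset_univ Ω) fun j _ _ => sq_nonneg _)
      rw [← sq_abs (inner ℝ w (u j))]
      exact pow_le_pow_left₀ hM (h2 j hj) 2
    -- For `w = 0` the level is `0` and the count cannot be divided by `‖w‖²`, but then all the
    -- coefficients vanish.
    by_cases hw : w = 0
    · have : Ω = ∅ := by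
        refine Finset.filter_eq_empty_iff.2 fun j _ => ?_
        rw [truncCoef, ← inner_eq_sum_mul, clip_eq_self, sub_self]
        · simp
        · rw [hw, inner_zero_left, abs_zero]; exact Real.sqrt_nonneg _
      rw [this]
      simp
    · have hw' : 0 < ‖w‖ ^ 2 := by positivity
      rw [hlev, mul_div_assoc', div_le_iff₀ hN'] at h3
      have : (D : ℝ) * Ω.card ≤ N := le_of_mul_le_mul_right (by linarith) hw'
      exact_mod_cast this
  · refine mul_le_mul_of_nonneg_left ?_ hη
    rw [← Real.sqrt_sq (norm_nonneg w), hu w]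
    refine Real.sqrt_le_sqrt (Finset.sum_le_sum fun j _ => sq_le_sq.2 ?_)
    rw [truncCoef, ← inner_eq_sum_mul]
    exact abs_sub_clip_le hM _

theorem norm_frameResidual_le (hN : 0 < N) (hD : 0 < D) {η : ℝ} (hη : 0 ≤ η) (hu : IsTightFrame u)
    (hup : HasUncertaintyPrinciple u D η) (w : Vec d) (n : ℕ) :
    ‖frameResidual D u w n‖ ≤ η ^ n * ‖w‖ := by
  induction n with
  | zero => simp [frameResidual]
  | succ n ih =>
    rw [frameResidual_succ, pow_succ']
    refine (norm_truncStep_le hN hD hη hu hup _).trans ?_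
    rw [mul_assoc]
    gcongr

theorem frameResidual_add_sum (w : Vec d) (n : ℕ) :
    frameResidual D u w n +
      ∑ j, (∑ s ∈ Finset.range n, truncCoef D u (frameResidual D u w s) j) • u j = w := by
  induction n with
  | zero => simp [frameResidual]
  | succ n ih =>
    simp only [Finset.sum_range_succ, add_smul, Finset.sum_add_distrib]
    rw [frameResidual_succ, truncStep]
    refine Eq.trans ?_ ih
    abel

/-- The truncation levels form a geometric series, giving `√D / (1 - η)`; the condition on `n` makes
the last residual so small that its untruncated coefficients add only `1`. Including them makes the
expansion exact after finitely many rounds. -/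
theorem isKashinRepresentation_kashinCoef (hN : 0 < N) (hD : 0 < D) {η : ℝ} (hη : 0 ≤ η)
    (hη1 : η < 1) (hu : IsTightFrame u) (hup : HasUncertaintyPrinciple u D η) {n : ℕ}
    (hn : η ^ n ≤ 1 / Real.sqrt N) {K : ℝ} (hK : Real.sqrt D / (1 - η) + 1 ≤ K) (w : Vec d) :
    IsKashinRepresentation u K w (kashinCoef D u n w) := by
  have hN' : (0 : ℝ) < N := mod_cast hN
  have hsN : 0 < Real.sqrt N := Real.sqrt_pos.2 hN'
  refine ⟨?_, fun j => ?_⟩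
  · simp only [kashinCoef, add_smul, Finset.sum_add_distrib, ← inner_eq_sum_mul,
      hu.sum_inner_smul]
    rw [add_comm, frameResidual_add_sum]
  · have h1 : ∀ s, |truncCoef D u (frameResidual D u w s) j| ≤
        η ^ s * (Real.sqrt D / Real.sqrt N * ‖w‖) := by
      intro s
      refine (abs_clip_le (Real.sqrt_nonneg _) _).trans ?_
      rw [← truncLevel, truncLevel_eq, mul_left_comm]
      gcongr
      exact norm_frameResidual_le hN hD hη hu hup w s
    have h2 : |∑ s ∈ Finset.range n, truncCoef D u (frameResidual D u w s) j| ≤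
        (1 - η)⁻¹ * (Real.sqrt D / Real.sqrt N * ‖w‖) := by
      refine (Finset.abs_sum_le_sum_abs _ _).trans ((Finset.sum_le_sum fun s _ => h1 s).trans ?_)
      rw [← Finset.sum_mul]
      refine mul_le_mul_of_nonneg_right ?_ (by positivity)
      rw [← tsum_geometric_of_lt_one hη hη1]
      exact (summable_geometric_of_lt_one hη hη1).sum_le_tsum _ fun i _ => pow_nonneg hη i
    have h3 : |∑ l, frameResidual D u w n l * u j l| ≤ 1 / Real.sqrt N * ‖w‖ := by
      rw [← inner_eq_sum_mul]
      refine (hu.abs_inner_le _ j).trans ((norm_frameResidual_le hN hD hη hu hup w n).trans ?_)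
      gcongr
    refine (abs_add_le _ _).trans ((add_le_add h2 h3).trans ?_)
    have h4 : (1 - η)⁻¹ * (Real.sqrt D / Real.sqrt N * ‖w‖) + 1 / Real.sqrt N * ‖w‖ =
        (Real.sqrt D / (1 - η) + 1) / Real.sqrt N * ‖w‖ := by ring
    rw [h4]
    gcongr

/-- Continuity provides the measurability of the queries and the integrability of the coefficients.
-/
theorem continuous_truncCoef (j : Fin N) : Continuous fun w : Vec d => truncCoef D u w j := by
  unfold truncCoef clip truncLevel
  fun_prop

theorem continuous_frameResidual (n : ℕ) : Continuous fun w : Vec d => frameResidual D u w n := by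
  induction n with
  | zero => exact continuous_id
  | succ n ih =>
    simp only [frameResidual_succ]
    have : Continuous (truncStep D u) := by
      unfold truncStep
      exact continuous_id.sub (continuous_finsetSum _ fun j _ =>
        (continuous_truncCoef j).smul continuous_const)
    exact this.comp ih

theorem continuous_kashinCoef (n : ℕ) (j : Fin N) :
    Continuous fun w : Vec d => kashinCoef D u n w j := by
  unfold kashinCoef
  refine (continuous_finsetSum _ fun s _ => (continuous_truncCoef j).comp
    (continuous_frameResidual s)).add ?_
  have := continuous_frameResidual (D := D) (u := u) n
  fun_prop

end

/-! ## Running times -/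

/-- The only register in the expression is register `0`. -/
def IExpr.IsDim : IExpr → Prop
  | .const _ => True
  | .reg k => k = 0
  | .add e f => e.IsDim ∧ f.IsDim
  | .sub e f => e.IsDim ∧ f.IsDim

noncomputable def IExpr.valueBound : IExpr → Polynomial ℕ
  | .const n => Polynomial.C n
  | .reg _ => Polynomial.X
  | .add e f => e.valueBound + f.valueBound
  | .sub e _ => e.valueBound

theorem IExpr.eval_le_valueBound (s : Store) {e : IExpr} (he : e.IsDim) :
    e.eval s ≤ e.valueBound.eval (s.idx 0) := by
  induction e with
  | const n => simp [IExpr.eval, IExpr.valueBound]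
  | reg k =>
    obtain rfl : k = 0 := he
    simp [IExpr.eval, IExpr.valueBound]
  | add e f ihe ihf =>
    rw [IExpr.eval, IExpr.valueBound, Polynomial.eval_add]
    exact add_le_add (ihe he.1) (ihf he.2)
  | sub e f ihe _ => exact (Nat.sub_le _ _).trans (ihe he.1)

/-- The program does not write to register `0`, and the numbers of rounds of its loops depend only
on this register. -/
def Prog.IsUniform : Prog → Prop
  | .skip => True
  | .setIdx k _ => k ≠ 0
  | .setCell _ _ _ _ => True
  | .seq p q => p.IsUniform ∧ q.IsUniform
  | .ifIdxLe _ _ p q => p.IsUniform ∧ q.IsUniform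
  | .ifRealLe _ _ p q => p.IsUniform ∧ q.IsUniform
  | .loop k e p => k ≠ 0 ∧ e.IsDim ∧ p.IsUniform

noncomputable def Prog.timeBound : Prog → Polynomial ℕ
  | .skip => 1
  | .setIdx _ e => Polynomial.C (e.cost + 1)
  | .setCell _ i j x => Polynomial.C (i.cost + j.cost + x.cost + 1)
  | .seq p q => p.timeBound + q.timeBound
  | .ifIdxLe e f p q => Polynomial.C (e.cost + f.cost + 1) + (p.timeBound + q.timeBound)
  | .ifRealLe x y p q => Polynomial.C (x.cost + y.cost + 1) + (p.timeBound + q.timeBound)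
  | .loop _ e p => Polynomial.C (e.cost + 1) + e.valueBound * (1 + p.timeBound)

/-- The invariant rule for loops, used for every loop below. -/
theorem loopState_induction {f : Store → Store} {k : ℕ} {s : Store} {n : ℕ}
    (P : ℕ → Store → Prop) (h0 : P 0 s)
    (h : ∀ i < n, ∀ t, P i t → P (i + 1) (f (t.setIdx k i))) : P n (loopState f k s n) := by
  induction n with
  | zero => exact h0
  | succ n ih => exact h n n.lt_succ_self _ (ih fun i hi => h i (hi.trans n.lt_succ_self))

theorem Prog.IsUniform.run_idx_zero {p : Prog} (hp : p.IsUniform) (s : Store) :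
    (p.run s).idx 0 = s.idx 0 := by
  induction p generalizing s with
  | skip => rfl
  | setIdx k e => exact Function.update_of_ne (Ne.symm hp) _ _
  | setCell => rfl
  | seq p q ihp ihq => rw [Prog.run, ihq hp.2, ihp hp.1]
  | ifIdxLe e f p q ihp ihq =>
    rw [Prog.run]
    split_ifs
    exacts [ihp hp.1 s, ihq hp.2 s]
  | ifRealLe x y p q ihp ihq =>
    rw [Prog.run]
    split_ifs
    exacts [ihp hp.1 s, ihq hp.2 s]
  | loop k e p ih =>
    refine loopState_induction (fun _ t => t.idx 0 = s.idx 0) rfl fun i _ t ht => ?_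
    rw [ih hp.2.2, ← ht]
    exact Function.update_of_ne (Ne.symm hp.1) _ _

/-- Since register `0` is never changed, one polynomial in it bounds every round of a loop as well
as the number of rounds. Branches are charged for both alternatives. -/
theorem Prog.IsUniform.steps_le {p : Prog} (hp : p.IsUniform) (s : Store) :
    p.steps s ≤ p.timeBound.eval (s.idx 0) := by
  induction p generalizing s with
  | skip => simp [Prog.steps, Prog.timeBound]
  | setIdx k e => simp [Prog.steps, Prog.timeBound]
  | setCell => simp [Prog.steps, Prog.timeBound]
  | seq p q ihp ihq =>
    have h2 := ihq hp.2 (p.run s)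
    rw [hp.1.run_idx_zero] at h2
    rw [Prog.steps, Prog.timeBound, Polynomial.eval_add]
    exact add_le_add (ihp hp.1 s) h2
  | ifIdxLe e f p q ihp ihq =>
    have h1 := ihp hp.1 s
    have h2 := ihq hp.2 s
    rw [Prog.steps, Prog.timeBound, Polynomial.eval_add, Polynomial.eval_C, Polynomial.eval_add]
    split_ifs <;> omega
  | ifRealLe x y p q ihp ihq =>
    have h1 := ihp hp.1 s
    have h2 := ihq hp.2 s
    rw [Prog.steps, Prog.timeBound, Polynomial.eval_add, Polynomial.eval_C, Polynomial.eval_add]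
    split_ifs <;> omega
  | loop k e p ih =>
    have hst : ∀ i, (loopState p.run k s i).idx 0 = s.idx 0 := by
      intro i
      refine loopState_induction (fun _ t => t.idx 0 = s.idx 0) rfl fun i _ t ht => ?_
      rw [hp.2.2.run_idx_zero, ← ht]
      exact Function.update_of_ne (Ne.symm hp.1) _ _
    rw [Prog.steps, Prog.timeBound, Polynomial.eval_add, Polynomial.eval_C, Polynomial.eval_mul,
      Polynomial.eval_add, Polynomial.eval_one]
    refine Nat.add_le_add_left ((Finset.sum_le_card_nsmul _ _
      (1 + p.timeBound.eval (s.idx 0)) fun i _ => ?_).trans ?_) _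
    · have := ih hp.2.2 ((loopState p.run k s i).setIdx k i)
      have h0 : ((loopState p.run k s i).setIdx k i).idx 0 = s.idx 0 :=
        (Function.update_of_ne (Ne.symm hp.1) _ _).trans (hst i)
      rw [h0] at this
      omega
    · rw [Finset.card_range, smul_eq_mul]
      exact Nat.mul_le_mul_right _ (IExpr.eval_le_valueBound s hp.2.1)

/-! ## Reasoning about loops -/

def Store.get (s : Store) (q : ℕ × ℕ × ℕ) : ℝ := s.cell q.1 q.2.1 q.2.2

theorem Store.get_mk (s : Store) (a i j : ℕ) : s.get (a, i, j) = s.cell a i j := rfl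

@[simp] theorem Store.get_setIdx (s : Store) (k n : ℕ) (q : ℕ × ℕ × ℕ) :
    (s.setIdx k n).get q = s.get q := rfl

@[simp] theorem Store.get_setCell (s : Store) (a i j : ℕ) (x : ℝ) (q : ℕ × ℕ × ℕ) :
    (s.setCell a i j x).get q = if q = (a, i, j) then x else s.get q := by
  simp only [Store.get, Store.setCell, Prod.ext_iff]

@[simp] theorem Store.idx_setCell (s : Store) (a i j : ℕ) (x : ℝ) :
    (s.setCell a i j x).idx = s.idx := rfl

theorem Store.idx_setIdx (s : Store) (k n r : ℕ) :
    (s.setIdx k n).idx r = if r = k then n else s.idx r := Function.update_apply _ _ _ _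

@[simp] theorem IExpr.eval_const (n : ℕ) (s : Store) : (IExpr.const n).eval s = n := rfl

@[simp] theorem IExpr.eval_reg (k : ℕ) (s : Store) : (IExpr.reg k).eval s = s.idx k := rfl

@[simp] theorem IExpr.eval_add (e f : IExpr) (s : Store) :
    (IExpr.add e f).eval s = e.eval s + f.eval s := rfl

@[simp] theorem RExpr.eval_const (q : ℚ) (s : Store) : (RExpr.const q).eval s = q := rfl

@[simp] theorem RExpr.eval_ofIdx (e : IExpr) (s : Store) : (RExpr.ofIdx e).eval s = e.eval s := rfl

@[simp] theorem RExpr.eval_add (x y : RExpr) (s : Store) :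
    (RExpr.add x y).eval s = x.eval s + y.eval s := rfl

@[simp] theorem RExpr.eval_sub (x y : RExpr) (s : Store) :
    (RExpr.sub x y).eval s = x.eval s - y.eval s := rfl

@[simp] theorem RExpr.eval_mul (x y : RExpr) (s : Store) :
    (RExpr.mul x y).eval s = x.eval s * y.eval s := rfl

@[simp] theorem RExpr.eval_div (x y : RExpr) (s : Store) :
    (RExpr.div x y).eval s = x.eval s / y.eval s := rfl

@[simp] theorem RExpr.eval_sqrt (x : RExpr) (s : Store) :
    (RExpr.sqrt x).eval s = Real.sqrt (x.eval s) := rfl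

@[simp] theorem RExpr.eval_cell (a : ℕ) (i j : IExpr) (s : Store) :
    (RExpr.cell a i j).eval s = s.get (a, i.eval s, j.eval s) := rfl

/-- The stores agree except on the registers in `R` and the cells in `W`. -/
structure Store.Agree (R : Set ℕ) (W : Set (ℕ × ℕ × ℕ)) (s t : Store) : Prop where
  idx : ∀ r ∉ R, t.idx r = s.idx r
  get : ∀ q ∉ W, t.get q = s.get q

theorem Store.Agree.refl (R : Set ℕ) (W : Set (ℕ × ℕ × ℕ)) (s : Store) : s.Agree R W s :=
  ⟨fun _ _ => rfl, fun _ _ => rfl⟩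

theorem Store.Agree.trans {R R' : Set ℕ} {W W' : Set (ℕ × ℕ × ℕ)} {s t t' : Store}
    (h : s.Agree R W t) (h' : t.Agree R' W' t') : s.Agree (R ∪ R') (W ∪ W') t' :=
  ⟨fun r hr => (h'.idx r fun h => hr (Or.inr h)).trans (h.idx r fun h => hr (Or.inl h)),
    fun q hq => (h'.get q fun h => hq (Or.inr h)).trans (h.get q fun h => hq (Or.inl h))⟩

theorem Store.Agree.mono {R R' : Set ℕ} {W W' : Set (ℕ × ℕ × ℕ)} {s t : Store}
    (h : s.Agree R W t) (hR : R ⊆ R') (hW : W ⊆ W') : s.Agree R' W' t :=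
  ⟨fun r hr => h.idx r fun h => hr (hR h), fun q hq => h.get q fun h => hq (hW h)⟩

theorem Store.agree_setIdx {R : Set ℕ} {W : Set (ℕ × ℕ × ℕ)} {k : ℕ} (hk : k ∈ R) (s : Store)
    (n : ℕ) : s.Agree R W (s.setIdx k n) :=
  ⟨fun r hr => by rw [Store.idx_setIdx, if_neg (ne_of_mem_of_not_mem hk hr).symm], fun _ _ => rfl⟩

theorem Store.agree_setCell {R : Set ℕ} {W : Set (ℕ × ℕ × ℕ)} {a i j : ℕ} (h : (a, i, j) ∈ W)
    (s : Store) (x : ℝ) : s.Agree R W (s.setCell a i j x) :=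
  ⟨fun _ _ => rfl, fun q hq => by rw [Store.get_setCell, if_neg (ne_of_mem_of_not_mem h hq).symm]⟩

/-- A loop which fills the cells `loc 0, …, loc (n - 1)` one after the other. -/
theorem Prog.run_fill {k : ℕ} {e : IExpr} {p : Prog} {s : Store} {n : ℕ} (he : e.eval s = n)
    {R : Set ℕ} (hk : k ∈ R) (loc : ℕ → ℕ × ℕ × ℕ) (hloc : Function.Injective loc) (G : ℕ → ℝ)
    (h : ∀ κ < n, ∀ t, s.Agree R (loc '' Set.Iio κ) t → t.idx k = κ →
      t.Agree R {loc κ} (p.run t) ∧ (p.run t).get (loc κ) = G κ) :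
    s.Agree R (loc '' Set.Iio n) ((Prog.loop k e p).run s) ∧
      ∀ κ < n, ((Prog.loop k e p).run s).get (loc κ) = G κ := by
  rw [Prog.run, he]
  refine loopState_induction
    (fun m t => s.Agree R (loc '' Set.Iio m) t ∧ ∀ κ < m, t.get (loc κ) = G κ)
    ⟨Store.Agree.refl _ _ s, by simp⟩ ?_
  rintro m hm t ⟨ht, htG⟩
  obtain ⟨h1, h2⟩ := h m hm (t.setIdx k m)
    ((ht.trans (Store.agree_setIdx (W := ∅) hk t m)).mono (by simp) (by simp))
    (by rw [Store.idx_setIdx, if_pos rfl])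
  refine ⟨?_, fun κ hκ => ?_⟩
  · refine ((ht.trans (Store.agree_setIdx (W := ∅) hk t m)).trans h1).mono (by simp) ?_
    rintro q ((⟨κ, hκ, rfl⟩ | hq) | hq)
    · exact ⟨κ, Nat.lt_succ_of_lt hκ, rfl⟩
    · exact hq.elim
    · exact ⟨m, m.lt_succ_self, hq.symm⟩
  · rcases Nat.lt_succ_iff_lt_or_eq.1 hκ with hκ | rfl
    -- Injectivity of `loc` protects the cells filled earlier.
    · rw [h1.get (loc κ) fun h => hκ.ne (hloc h), Store.get_setIdx, htG κ hκ]
    · exact h2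

/-- A loop which accumulates a sum in a cell. -/
theorem Prog.run_accumulate {k : ℕ} {e : IExpr} {s : Store} {n : ℕ} (he : e.eval s = n)
    (a I J : ℕ) {i j : IExpr} {x : RExpr} (F : ℕ → ℝ)
    (h : ∀ κ < n, ∀ t, s.Agree {k} {(a, I, J)} t → t.idx k = κ →
      i.eval t = I ∧ j.eval t = J ∧ x.eval t = F κ) :
    s.Agree {k} {(a, I, J)} ((Prog.loop k e (.setCell a i j (.add (.cell a i j) x))).run s) ∧
      ((Prog.loop k e (.setCell a i j (.add (.cell a i j) x))).run s).get (a, I, J) =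
        s.get (a, I, J) + ∑ κ ∈ Finset.range n, F κ := by
  rw [Prog.run, he]
  refine loopState_induction (fun m t => s.Agree {k} {(a, I, J)} t ∧
    t.get (a, I, J) = s.get (a, I, J) + ∑ κ ∈ Finset.range m, F κ)
    ⟨Store.Agree.refl _ _ s, by simp⟩ ?_
  rintro m hm t ⟨ht, htF⟩
  have h0 : s.Agree {k} {(a, I, J)} (t.setIdx k m) :=
    (ht.trans (Store.agree_setIdx (W := ∅) (Set.mem_singleton k) t m)).mono (by simp) (by simp)
  obtain ⟨h1, h2, h3⟩ := h m hm (t.setIdx k m) h0 (by rw [Store.idx_setIdx, if_pos rfl])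
  rw [Prog.run, h1, h2]
  refine ⟨(h0.trans (Store.agree_setCell (R := ∅) (Set.mem_singleton _) _ _)).mono (by simp)
    (by simp), ?_⟩
  rw [Store.get_setCell, if_pos rfl, RExpr.eval, h3, RExpr.eval_cell, h1, h2, Store.get_setIdx,
    htF, Finset.sum_range_succ, add_assoc]

/-- Store the sum of the values of `x` for `k = 0, 1, …` in a cell. -/
def sumProg (k : ℕ) (e : IExpr) (a : ℕ) (i j : IExpr) (x : RExpr) : Prog :=
  .seq (.setCell a i j (.const 0)) (.loop k e (.setCell a i j (.add (.cell a i j) x)))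

theorem run_sumProg {k : ℕ} {e : IExpr} {s : Store} {n a I J : ℕ} {i j : IExpr} {x : RExpr}
    (he : ∀ c, e.eval (s.setCell a I J c) = n) (hi : i.eval s = I) (hj : j.eval s = J)
    (F : ℕ → ℝ)
    (h : ∀ κ < n, ∀ t, s.Agree {k} {(a, I, J)} t → t.idx k = κ →
      i.eval t = I ∧ j.eval t = J ∧ x.eval t = F κ) :
    s.Agree {k} {(a, I, J)} ((sumProg k e a i j x).run s) ∧
      ((sumProg k e a i j x).run s).get (a, I, J) = ∑ κ ∈ Finset.range n, F κ := by
  simp only [sumProg, Prog.run, hi, hj]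
  have h0 : s.Agree {k} {(a, I, J)} (s.setCell a I J ((RExpr.const 0).eval s)) :=
    Store.agree_setCell (Set.mem_singleton _) _ _
  obtain ⟨h1, h2⟩ := Prog.run_accumulate (he _) a I J F fun κ hκ t ht htk =>
    h κ hκ t ((h0.trans ht).mono (by simp) (by simp)) htk
  refine ⟨(h0.trans h1).mono (by simp) (by simp), h2.trans ?_⟩
  rw [Store.get_setCell, if_pos rfl, RExpr.eval, Rat.cast_zero, zero_add]

/-! ## The query program -/

def twoDim : IExpr := .add (.reg 0) (.reg 0)

/-- Cell `(0, 0)` of array `6`: the truncation level of row `0` of array `2`. -/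
def levelProg (D : ℕ) : Prog :=
  .seq (sumProg 5 (.reg 0) 6 (.const 0) (.const 0)
      (.mul (.cell 2 (.const 0) (.reg 5)) (.cell 2 (.const 0) (.reg 5))))
    (.setCell 6 (.const 0) (.const 0)
      (.sqrt (.div (.mul (.ofIdx (.const D)) (.cell 6 (.const 0) (.const 0))) (.ofIdx twoDim))))

/-- The inner product of row `0` of array `2` with the current frame vector. -/
def dotProg : Prog :=
  sumProg 5 (.reg 0) 5 (.const 0) (.reg 4)
    (.mul (.cell 2 (.const 0) (.reg 5)) (.cell 1 (.reg 4) (.reg 5)))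

/-- Absolute values are computed as `√(x * x)`, so no branching is needed. -/
def clipExpr (M b : RExpr) : RExpr :=
  .div (.sub (.sqrt (.mul (.add b M) (.add b M))) (.sqrt (.mul (.sub b M) (.sub b M)))) (.const 2)

def truncProg : Prog :=
  .loop 4 twoDim (.seq dotProg (.setCell 5 (.const 0) (.reg 4)
    (clipExpr (.cell 6 (.const 0) (.const 0)) (.cell 5 (.const 0) (.reg 4)))))

def accumulateProg : Prog :=
  .loop 4 twoDim (.setCell 4 (.const 0) (.reg 4)
    (.add (.cell 4 (.const 0) (.reg 4)) (.cell 5 (.const 0) (.reg 4))))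

/-- The subtraction is phrased as accumulation of negated terms, to fit `Prog.run_accumulate`. -/
def updateProg : Prog :=
  .loop 5 (.reg 0) (.loop 4 twoDim (.setCell 2 (.const 0) (.reg 5)
    (.add (.cell 2 (.const 0) (.reg 5))
      (.mul (.sub (.const 0) (.cell 5 (.const 0) (.reg 4))) (.cell 1 (.reg 4) (.reg 5))))))

def roundProg (D : ℕ) : Prog :=
  .seq (levelProg D) (.seq truncProg (.seq accumulateProg updateProg))

/-- Index expressions have no product, so `R * d` rounds are two nested loops. The later run of
`dotProg` refills array `5` with the untruncated coefficients of the last residual. -/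
def queryProg (D R K : ℕ) : Prog :=
  .seq (.loop 2 (.const R) (.loop 3 (.reg 0) (roundProg D)))
    (.seq (.loop 4 twoDim dotProg)
      (.setCell 3 (.const 0) (.const 0)
        (.mul (.div (.sqrt (.ofIdx twoDim)) (.ofIdx (.const K)))
          (.add (.cell 4 (.const 0) (.reg 1)) (.cell 5 (.const 0) (.reg 1))))))

theorem isUniform_queryProg (D R K : ℕ) : (queryProg D R K).IsUniform := by
  simp [queryProg, roundProg, levelProg, truncProg, accumulateProg, updateProg, dotProg, sumProg,
    Prog.IsUniform, IExpr.IsDim, twoDim]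

@[simp] theorem eval_twoDim (s : Store) : twoDim.eval s = 2 * s.idx 0 := by
  simp [twoDim, two_mul]

@[simp] theorem eval_clipExpr (M b : RExpr) (s : Store) :
    (clipExpr M b).eval s = clip (M.eval s) (b.eval s) := by
  simp [clipExpr, clip, Real.sqrt_mul_self_eq_abs]

theorem run_dotProg (s : Store) :
    s.Agree {5} {(5, 0, s.idx 4)} (dotProg.run s) ∧ (dotProg.run s).get (5, 0, s.idx 4) =
      ∑ l ∈ Finset.range (s.idx 0), s.get (2, 0, l) * s.get (1, s.idx 4, l) := by
  refine run_sumProg (n := s.idx 0) (I := 0) (J := s.idx 4) (fun c => rfl) rfl rfl _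
    fun κ _ t ht htk => ?_
  have h4 := ht.idx 4 (by simp)
  refine ⟨rfl, h4, ?_⟩
  simp only [RExpr.eval_mul, RExpr.eval_cell, IExpr.eval_reg, IExpr.eval_const, htk, h4]
  rw [ht.get _ (by simp), ht.get _ (by simp)]

/-- The store holds the dimension, the frame, the index of the query and the current vector. -/
structure HoldsQuery {d : ℕ} (u : Fin (2 * d) → Vec d) (j : ℕ) (w : Vec d) (s : Store) :
    Prop where
  dim : s.idx 0 = d
  query : s.idx 1 = j
  frame : ∀ (i : Fin (2 * d)) (l : Fin d), s.get (1, i, l) = u i l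
  vec : ∀ l : Fin d, s.get (2, 0, l) = w l

section

variable {d : ℕ} {u : Fin (2 * d) → Vec d} {j : ℕ} {w : Vec d} {s t : Store}

theorem HoldsQuery.of_agree (h : HoldsQuery u j w s) {R : Set ℕ} {W : Set (ℕ × ℕ × ℕ)}
    (ht : s.Agree R W t) (hR0 : 0 ∉ R) (hR1 : 1 ∉ R) (hW : ∀ q ∈ W, 2 < q.1) :
    HoldsQuery u j w t :=
  ⟨(ht.idx 0 hR0).trans h.dim, (ht.idx 1 hR1).trans h.query,
    fun i l => (ht.get _ fun hq => absurd (hW _ hq) (by simp)).trans (h.frame i l),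
    fun l => (ht.get _ fun hq => absurd (hW _ hq) (by simp)).trans (h.vec l)⟩

theorem HoldsQuery.run_levelProg (h : HoldsQuery u j w s) (D : ℕ) :
    s.Agree {5} {(6, 0, 0)} ((levelProg D).run s) ∧
      ((levelProg D).run s).get (6, 0, 0) = truncLevel (2 * d) D w := by
  obtain ⟨h1, h2⟩ := run_sumProg (k := 5) (e := .reg 0) (s := s) (n := d) (a := 6) (I := 0)
    (J := 0) (i := .const 0) (j := .const 0)
    (x := .mul (.cell 2 (.const 0) (.reg 5)) (.cell 2 (.const 0) (.reg 5)))
    (fun c => h.dim) rfl rfl (fun l => s.get (2, 0, l) * s.get (2, 0, l))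
    fun κ _ t ht htk => by
      refine ⟨rfl, rfl, ?_⟩
      simp only [RExpr.eval_mul, RExpr.eval_cell, IExpr.eval_reg, IExpr.eval_const, htk]
      rw [ht.get _ (by simp)]
  refine ⟨(h1.trans (Store.agree_setCell (R := ∅) (Set.mem_singleton _) _ _)).mono
    (by simp) (by simp), ?_⟩
  simp only [levelProg, Prog.run, IExpr.eval_const, Store.get_setCell, if_true, RExpr.eval_sqrt,
    RExpr.eval_div, RExpr.eval_mul, RExpr.eval_ofIdx, RExpr.eval_cell, eval_twoDim]
  rw [h2, h1.idx 0 (by simp), h.dim, Finset.sum_range, truncLevel]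
  simp only [h.vec]

theorem HoldsQuery.run_fill_dot (h : HoldsQuery u j w s) (g : Store → ℝ → ℝ) (p : Prog)
    (hp : ∀ t, HoldsQuery u j w t → t.get (6, 0, 0) = s.get (6, 0, 0) →
      t.Agree {5} {(5, 0, t.idx 4)} (p.run t) ∧ (p.run t).get (5, 0, t.idx 4) =
        g s (∑ l ∈ Finset.range (t.idx 0), t.get (2, 0, l) * t.get (1, t.idx 4, l))) :
    s.Agree {4, 5} ((fun i => (5, 0, i)) '' Set.Iio (2 * d)) ((Prog.loop 4 twoDim p).run s) ∧
      ∀ i : Fin (2 * d), ((Prog.loop 4 twoDim p).run s).get (5, 0, i) =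
        g s (∑ l, w l * u i l) := by
  obtain ⟨h1, h2⟩ := Prog.run_fill (k := 4) (e := twoDim) (p := p) (s := s) (n := 2 * d)
    (by rw [eval_twoDim, h.dim]) (R := {4, 5}) (by simp) (fun i => (5, 0, i))
    (fun i i' hi => by simpa using hi)
    (fun i => g s (∑ l ∈ Finset.range d, s.get (2, 0, l) * s.get (1, i, l)))
    fun κ _ t ht htk => by
      have hq := h.of_agree ht (by simp) (by simp) (by simp)
      obtain ⟨h1, h2⟩ := hp t hq (ht.get _ (by simp))
      rw [htk] at h1 h2
      refine ⟨h1.mono (by simp) (by simp), h2.trans ?_⟩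
      rw [hq.dim]
      congr 1
      refine Finset.sum_congr rfl fun l _ => ?_
      rw [ht.get _ (by simp), ht.get _ (by simp)]
  refine ⟨h1, fun i => ?_⟩
  rw [h2 i i.2, Finset.sum_range]
  simp only [h.vec, h.frame]

theorem HoldsQuery.run_truncProg (h : HoldsQuery u j w s) {D : ℕ}
    (hM : s.get (6, 0, 0) = truncLevel (2 * d) D w) :
    s.Agree {4, 5} ((fun i => (5, 0, i)) '' Set.Iio (2 * d)) (truncProg.run s) ∧
      ∀ i : Fin (2 * d), (truncProg.run s).get (5, 0, i) = truncCoef D u w i := by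
  refine h.run_fill_dot (fun _ b => clip (truncLevel (2 * d) D w) b) _ fun t _ ht => ?_
  obtain ⟨h1, h2⟩ := run_dotProg t
  rw [Prog.run, Prog.run]
  simp only [IExpr.eval_reg, IExpr.eval_const, h1.idx 4 (by simp)]
  refine ⟨(h1.trans (Store.agree_setCell (R := ∅) (Set.mem_singleton _) _ _)).mono
    (by simp) (by simp), ?_⟩
  rw [Store.get_setCell, if_pos rfl, eval_clipExpr, RExpr.eval_cell, RExpr.eval_cell]
  simp only [IExpr.eval_reg, IExpr.eval_const, h1.idx 4 (by simp)]
  rw [h2, h1.get _ (by simp), ht, hM]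

theorem run_accumulateProg (hd : s.idx 0 = d) :
    s.Agree {4} ((fun i => (4, 0, i)) '' Set.Iio (2 * d)) (accumulateProg.run s) ∧
      ∀ i < 2 * d, (accumulateProg.run s).get (4, 0, i) =
        s.get (4, 0, i) + s.get (5, 0, i) := by
  refine Prog.run_fill (by rw [eval_twoDim, hd]) (by simp) (fun i => (4, 0, i))
    (fun i i' hi => by simpa using hi) _ fun κ _ t ht htk => ?_
  simp only [Prog.run, IExpr.eval_reg, IExpr.eval_const, htk]
  refine ⟨Store.agree_setCell (Set.mem_singleton _) _ _, ?_⟩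
  simp only [Store.get_setCell, if_true, RExpr.eval_add, RExpr.eval_cell, IExpr.eval_reg,
    IExpr.eval_const, htk]
  rw [ht.get _ (by simp), ht.get _ (by simp)]

theorem run_updateProg (hd : s.idx 0 = d) :
    s.Agree {4, 5} ((fun l => (2, 0, l)) '' Set.Iio d) (updateProg.run s) ∧
      ∀ l < d, (updateProg.run s).get (2, 0, l) = s.get (2, 0, l) +
        ∑ i ∈ Finset.range (2 * d), (0 - s.get (5, 0, i)) * s.get (1, i, l) := by
  refine Prog.run_fill (e := .reg 0) hd (by simp) (fun l => (2, 0, l))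
    (fun i i' hi => by simpa using hi) _ fun κ _ t ht htk => ?_
  obtain ⟨h1, h2⟩ := Prog.run_accumulate (k := 4) (e := twoDim) (s := t) (n := 2 * d)
    (by rw [eval_twoDim, ht.idx 0 (by simp), hd]) 2 0 κ (i := .const 0) (j := .reg 5)
    (x := .mul (.sub (.const 0) (.cell 5 (.const 0) (.reg 4))) (.cell 1 (.reg 4) (.reg 5)))
    (fun i => (0 - s.get (5, 0, i)) * s.get (1, i, κ)) fun i _ t' ht' htk' => by
      have h5 : t'.idx 5 = κ := by rw [ht'.idx 5 (by simp), htk]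
      refine ⟨rfl, h5, ?_⟩
      simp only [RExpr.eval_mul, RExpr.eval_sub, RExpr.eval_const, RExpr.eval_cell,
        IExpr.eval_reg, IExpr.eval_const, htk', h5, Rat.cast_zero]
      rw [ht'.get _ (by simp), ht'.get _ (by simp), ht.get _ (by simp),
        ht.get _ (by simp)]
  refine ⟨h1.mono (by simp) (by simp), h2.trans ?_⟩
  rw [ht.get _ (by simp)]

theorem HoldsQuery.run_roundProg (h : HoldsQuery u j w s) (D : ℕ) :
    HoldsQuery u j (truncStep D u w) ((roundProg D).run s) ∧
      ∀ i : Fin (2 * d), ((roundProg D).run s).get (4, 0, i) =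
        s.get (4, 0, i) + truncCoef D u w i := by
  obtain ⟨a1, b1⟩ := h.run_levelProg D
  have h1 := h.of_agree a1 (by simp) (by simp) (by simp)
  obtain ⟨a2, b2⟩ := h1.run_truncProg b1
  have h2 := h1.of_agree a2 (by simp) (by simp) (by simp)
  obtain ⟨a3, b3⟩ := run_accumulateProg h2.dim
  have h3 := h2.of_agree a3 (by simp) (by simp) (by simp)
  obtain ⟨a4, b4⟩ := run_updateProg h3.dim
  simp only [roundProg, Prog.run]
  refine ⟨⟨(a4.idx 0 (by simp)).trans h3.dim, (a4.idx 1 (by simp)).trans h3.query, fun i l => ?_,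
    fun l => ?_⟩, fun i => ?_⟩
  · rw [a4.get _ (by simp), h3.frame]
  · rw [b4 l l.2, h3.vec, Finset.sum_range]
    simp only [h3.frame]
    have : ∀ i : Fin (2 * d), (accumulateProg.run (truncProg.run ((levelProg D).run s))).get
        (5, 0, i) = truncCoef D u w i := fun i => by rw [a3.get _ (by simp), b2]
    simp only [this, truncStep]
    simp [sub_eq_add_neg]
  · rw [a4.get _ (by simp), b3 i i.2, b2, a2.get _ (by simp), a1.get _ (by simp)]

theorem HoldsQuery.run_rounds (h : HoldsQuery u j w s) (h0 : ∀ i, s.get (4, 0, i) = 0) (D R : ℕ) :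
    HoldsQuery u j (frameResidual D u w (R * d))
      ((Prog.loop 2 (.const R) (.loop 3 (.reg 0) (roundProg D))).run s) ∧
      ∀ i : Fin (2 * d),
        ((Prog.loop 2 (.const R) (.loop 3 (.reg 0) (roundProg D))).run s).get (4, 0, i) =
          ∑ n ∈ Finset.range (R * d), truncCoef D u (frameResidual D u w n) i := by
  -- One invariant indexed by the total number of rounds serves both loops: `m * d` at the outer
  -- level and `m * d + n` at the inner one.
  let P : ℕ → Store → Prop := fun n t => HoldsQuery u j (frameResidual D u w n) t ∧
    ∀ i : Fin (2 * d), t.get (4, 0, i) =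
      ∑ m ∈ Finset.range n, truncCoef D u (frameResidual D u w m) i
  have hset : ∀ n t k m, 1 < k → P n t → P n (t.setIdx k m) := by
    rintro n t k m hk ⟨h1, h2⟩
    exact ⟨h1.of_agree (Store.agree_setIdx (R := {k}) (W := ∅) (by simp) t m)
      (by simp; omega) (by simp; omega) (by simp), h2⟩
  have hround : ∀ n t, P n t → P (n + 1) ((roundProg D).run t) := by
    rintro n t ⟨h1, h2⟩
    obtain ⟨h3, h4⟩ := h1.run_roundProg D
    refine ⟨by rwa [frameResidual_succ], fun i => ?_⟩
    rw [h4, h2, Finset.sum_range_succ]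
  change P (R * d) _
  rw [Prog.run]
  refine loopState_induction (fun n t => P (n * d) t) ?_ fun m _ t ht => ?_
  · rw [zero_mul]
    exact ⟨h, fun i => by simpa using h0 i⟩
  · have h1 := hset _ t 2 m (by norm_num) ht
    rw [Prog.run, add_mul, one_mul]
    have h2 : (IExpr.reg 0).eval (t.setIdx 2 m) = d := h1.1.dim
    rw [h2]
    refine loopState_induction (fun n t => P (m * d + n) t) h1 fun n _ t ht => ?_
    exact hround _ _ (hset _ t 3 n (by norm_num) ht)

end

theorem holdsQuery_queryInput {d : ℕ} (u : Fin (2 * d) → Vec d) (j : Fin (2 * d)) (w : Vec d) :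
    HoldsQuery u j w (SQAlgorithm.queryInput u j w) where
  dim := rfl
  query := rfl
  frame i l := by
    simp [Store.get, SQAlgorithm.queryInput, inputStore, frameArray]
  vec l := by
    simp [Store.get, SQAlgorithm.queryInput, inputStore, rowArray]

theorem run_queryProg {d : ℕ} (u : Fin (2 * d) → Vec d) (j : Fin (2 * d)) (w : Vec d)
    (D R K : ℕ) :
    ((queryProg D R K).run (SQAlgorithm.queryInput u j w)).get (3, 0, 0) =
      Real.sqrt ((2 * d : ℕ) : ℝ) / K * kashinCoef D u (R * d) w j := by
  obtain ⟨h1, h2⟩ := (holdsQuery_queryInput u j w).run_rounds (fun _ => rfl) D R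
  obtain ⟨h3, h4⟩ := h1.run_fill_dot (fun _ b => b) dotProg fun t _ _ => run_dotProg t
  have h5 := h1.of_agree h3 (by simp) (by simp) (by simp)
  rw [queryProg, Prog.run, Prog.run, Prog.run]
  simp only [IExpr.eval_const, IExpr.eval_reg, Store.get_setCell, if_true, RExpr.eval_mul,
    RExpr.eval_div, RExpr.eval_sqrt, RExpr.eval_add, RExpr.eval_ofIdx, RExpr.eval_cell, eval_twoDim]
  rw [h5.query, h5.dim, h4, h3.get _ (by simp), h2, kashinCoef]

/-! ## The decoding program -/

def decodeProg (K : ℕ) : Prog :=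
  .loop 2 (.reg 0) (.loop 3 twoDim (.setCell 3 (.const 0) (.reg 2)
    (.add (.cell 3 (.const 0) (.reg 2))
      (.mul (.mul (.cell 2 (.const 0) (.reg 3)) (.div (.ofIdx (.const K)) (.sqrt (.ofIdx twoDim))))
        (.cell 1 (.reg 3) (.reg 2))))))

theorem isUniform_decodeProg (K : ℕ) : (decodeProg K).IsUniform := by
  simp [decodeProg, Prog.IsUniform, IExpr.IsDim, twoDim]

theorem run_decodeProg {d : ℕ} (u : Fin (2 * d) → Vec d) (v : Fin (2 * d) → ℝ) (K : ℕ)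
    (l : Fin d) :
    ((decodeProg K).run (SQAlgorithm.decodeInput u v)).get (3, 0, l) =
      ∑ i, v i * (K / Real.sqrt ((2 * d : ℕ) : ℝ)) * u i l := by
  set s := SQAlgorithm.decodeInput u v with hs
  have hd : s.idx 0 = d := rfl
  obtain ⟨-, h⟩ := Prog.run_fill (k := 2) (e := .reg 0) (s := s) (n := d) (R := {2, 3})
    (p := .loop 3 twoDim (.setCell 3 (.const 0) (.reg 2)
      (.add (.cell 3 (.const 0) (.reg 2))
        (.mul (.mul (.cell 2 (.const 0) (.reg 3))
          (.div (.ofIdx (.const K)) (.sqrt (.ofIdx twoDim)))) (.cell 1 (.reg 3) (.reg 2))))))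
    hd (by simp) (fun l => (3, 0, l)) (fun i i' hi => by simpa using hi)
    (fun l => ∑ i ∈ Finset.range (2 * d),
      s.get (2, 0, i) * (K / Real.sqrt ((2 * d : ℕ) : ℝ)) * s.get (1, i, l))
    fun κ _ t ht htk => by
      obtain ⟨h1, h2⟩ := Prog.run_accumulate (k := 3) (e := twoDim) (s := t) (n := 2 * d)
        (by rw [eval_twoDim, ht.idx 0 (by simp), hd]) 3 0 κ (i := .const 0) (j := .reg 2)
        (x := .mul (.mul (.cell 2 (.const 0) (.reg 3))
            (.div (.ofIdx (.const K)) (.sqrt (.ofIdx twoDim)))) (.cell 1 (.reg 3) (.reg 2)))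
        (fun i => s.get (2, 0, i) * (K / Real.sqrt ((2 * d : ℕ) : ℝ)) * s.get (1, i, κ))
        fun i _ t' ht' htk' => by
          have h2 : t'.idx 2 = κ := by rw [ht'.idx 2 (by simp), htk]
          refine ⟨rfl, h2, ?_⟩
          simp only [RExpr.eval_mul, RExpr.eval_div, RExpr.eval_sqrt, RExpr.eval_ofIdx,
            RExpr.eval_cell, IExpr.eval_reg, IExpr.eval_const, htk', h2, eval_twoDim]
          rw [ht'.idx 0 (by simp), ht.idx 0 (by simp), hd,
            ht'.get _ (by simp), ht'.get _ (by simp), ht.get _ (by simp), ht.get _ (by simp)]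
      refine ⟨h1.mono (by simp) (by simp), h2.trans ?_⟩
      rw [ht.get _ (by simp)]
      -- Accumulation starts without a reset, because array `3` is `0` in the input store.
      have : s.get (3, 0, κ) = 0 := rfl
      rw [this, zero_add]
  rw [decodeProg, h l l.2, Finset.sum_range]
  refine Finset.sum_congr rfl fun i _ => ?_
  simp [Store.get, hs, SQAlgorithm.decodeInput, inputStore, rowArray, frameArray]

/-! ## Gram–Schmidt orthonormalization of the rows of `[I | M]` -/

/-- The first `m` rows of `Q` are orthonormal vectors of the form `(p, Mᵀ p)` with `p` supported on
an initial segment, and the other rows vanish. -/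
structure IsPartialBasis (d m : ℕ) (M Q : ℕ → ℕ → ℝ) : Prop where
  orthonormal : ∀ l < m, ∀ l' < m,
    ∑ j ∈ Finset.range (2 * d), Q l j * Q l' j = if l = l' then 1 else 0
  zero : ∀ l < d, m ≤ l → ∀ j < 2 * d, Q l j = 0
  triangular : ∀ l < m, ∀ j < d, l < j → Q l j = 0
  mem : ∀ l < m, ∀ k < d, Q l (d + k) = ∑ i ∈ Finset.range d, Q l i * M i k

/-- The vector `g` has the form `(p, Mᵀ p)`, the last nonzero entry of `p` is `p m = 1`, and `g` is
orthogonal to the first `l` rows of `Q`. -/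
structure IsWorkRow (d m l : ℕ) (M Q : ℕ → ℕ → ℝ) (g : ℕ → ℝ) : Prop where
  orthogonal : ∀ l' < m, l' < l → ∑ j ∈ Finset.range (2 * d), g j * Q l' j = 0
  pivot : g m = 1
  triangular : ∀ j < d, m < j → g j = 0
  mem : ∀ k < d, g (d + k) = ∑ i ∈ Finset.range d, g i * M i k

/-- Modified Gram–Schmidt: subtracting a multiple of row `l` keeps the orthogonality to the earlier
rows. The pivot survives because finished rows vanish at position `m`. For `l ≥ m` row `l` is still
zero and nothing changes, so the loop may run over all `d` rows. -/
theorem IsWorkRow.step {d m l : ℕ} {M Q : ℕ → ℕ → ℝ} {g g' : ℕ → ℝ}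
    (hQ : IsPartialBasis d m M Q) (hm : m < d) (hl : l < d) (hg : IsWorkRow d m l M Q g)
    (hg' : ∀ j < 2 * d, g' j = g j - (∑ i ∈ Finset.range (2 * d), g i * Q l i) * Q l j) :
    IsWorkRow d m (l + 1) M Q g' := by
  rcases lt_or_ge l m with hlm | hlm
  · refine ⟨fun l' hl' hl'l => ?_, ?_, fun j hj hmj => ?_, fun k hk => ?_⟩
    · have h1 : ∑ j ∈ Finset.range (2 * d), g' j * Q l' j =
          ∑ j ∈ Finset.range (2 * d), g j * Q l' j -
            (∑ i ∈ Finset.range (2 * d), g i * Q l i) *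
              ∑ j ∈ Finset.range (2 * d), Q l j * Q l' j := by
        rw [Finset.mul_sum, ← Finset.sum_sub_distrib]
        refine Finset.sum_congr rfl fun j hj => ?_
        rw [hg' j (Finset.mem_range.1 hj)]
        ring
      rw [h1, hQ.orthonormal l hlm l' hl']
      rcases Nat.lt_succ_iff_lt_or_eq.1 hl'l with h | rfl
      · rw [hg.orthogonal l' hl' h, if_neg h.ne']
        ring
      · rw [if_pos rfl]
        ring
    · rw [hg' m (by omega), hg.pivot, hQ.triangular l hlm m hm hlm]
      ring
    · rw [hg' j (by omega), hg.triangular j hj hmj, hQ.triangular l hlm j hj (by omega)]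
      ring
    · rw [hg' _ (by omega), hg.mem k hk, hQ.mem l hlm k hk, Finset.mul_sum,
        ← Finset.sum_sub_distrib]
      refine Finset.sum_congr rfl fun i hi => ?_
      rw [hg' i (by have := Finset.mem_range.1 hi; omega)]
      ring
  · have h0 : ∀ j < 2 * d, g' j = g j := fun j hj => by
      rw [hg' j hj, hQ.zero l hl hlm j hj]
      ring
    refine ⟨fun l' hl' hl'l => ?_, ?_, fun j hj hmj => ?_, fun k hk => ?_⟩
    · rw [← hg.orthogonal l' hl' (by omega)]
      exact Finset.sum_congr rfl fun j hj => by rw [h0 j (Finset.mem_range.1 hj)]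
    · rw [h0 m (by omega), hg.pivot]
    · rw [h0 j (by omega), hg.triangular j hj hmj]
    · rw [h0 _ (by omega), hg.mem k hk]
      exact Finset.sum_congr rfl fun i hi => by
        rw [h0 i (by have := Finset.mem_range.1 hi; omega)]

/-- The pivot `g m = 1` makes the norm positive, so normalization never divides by `0`, whatever the
coin flips. -/
theorem IsPartialBasis.succ {d m : ℕ} {M Q Q' : ℕ → ℕ → ℝ} {g : ℕ → ℝ}
    (hQ : IsPartialBasis d m M Q) (hm : m < d) (hg : IsWorkRow d m d M Q g)
    (hQ' : ∀ l ≠ m, ∀ j < 2 * d, Q' l j = Q l j)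
    (hQm : ∀ j < 2 * d, Q' m j = g j / Real.sqrt (∑ i ∈ Finset.range (2 * d), g i * g i)) :
    IsPartialBasis d (m + 1) M Q' := by
  set r := Real.sqrt (∑ i ∈ Finset.range (2 * d), g i * g i) with hr
  have hpos : 0 < ∑ i ∈ Finset.range (2 * d), g i * g i := by
    refine Finset.sum_pos' (fun i _ => mul_self_nonneg _) ⟨m, Finset.mem_range.2 (by omega), ?_⟩
    rw [hg.pivot]
    norm_num
  have hrr : r * r = ∑ i ∈ Finset.range (2 * d), g i * g i := Real.mul_self_sqrt hpos.le
  have hr0 : r ≠ 0 := (Real.sqrt_pos.2 hpos).ne'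
  have hmix : ∀ l < m, ∑ j ∈ Finset.range (2 * d), Q' m j * Q' l j = 0 := by
    intro l hl
    have : ∑ j ∈ Finset.range (2 * d), Q' m j * Q' l j =
        (∑ j ∈ Finset.range (2 * d), g j * Q l j) / r := by
      rw [Finset.sum_div]
      refine Finset.sum_congr rfl fun j hj => ?_
      rw [hQm j (Finset.mem_range.1 hj), hQ' l hl.ne j (Finset.mem_range.1 hj)]
      ring
    rw [this, hg.orthogonal l hl (hl.trans hm), zero_div]
  refine ⟨fun l hl l' hl' => ?_, fun l hl hml j hj => ?_, fun l hl j hj hlj => ?_,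
    fun l hl k hk => ?_⟩
  · rcases Nat.lt_succ_iff_lt_or_eq.1 hl with hl | rfl <;>
      rcases Nat.lt_succ_iff_lt_or_eq.1 hl' with hl' | rfl
    · rw [← hQ.orthonormal l hl l' hl']
      exact Finset.sum_congr rfl fun j hj => by
        rw [hQ' l hl.ne j (Finset.mem_range.1 hj), hQ' l' hl'.ne j (Finset.mem_range.1 hj)]
    · rw [if_neg hl.ne, ← hmix l hl]
      exact Finset.sum_congr rfl fun j _ => mul_comm _ _
    · rw [if_neg hl'.ne', hmix l' hl']
    · rw [if_pos rfl]
      have : ∑ j ∈ Finset.range (2 * d), Q' l' j * Q' l' j =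
          (∑ j ∈ Finset.range (2 * d), g j * g j) / (r * r) := by
        rw [Finset.sum_div]
        refine Finset.sum_congr rfl fun j hj => ?_
        rw [hQm j (Finset.mem_range.1 hj)]
        field_simp
      rw [this, hrr, div_self hpos.ne']
  · rw [hQ' l (by omega) j hj, hQ.zero l hl (by omega) j hj]
  · rcases Nat.lt_succ_iff_lt_or_eq.1 hl with hl | rfl
    · rw [hQ' l hl.ne j (by omega), hQ.triangular l hl j hj hlj]
    · rw [hQm j (by omega), hg.triangular j hj hlj, zero_div]
  · rcases Nat.lt_succ_iff_lt_or_eq.1 hl with hl | rfl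
    · rw [hQ' l hl.ne _ (by omega), hQ.mem l hl k hk]
      exact Finset.sum_congr rfl fun i hi => by
        rw [hQ' l hl.ne i (by have := Finset.mem_range.1 hi; omega)]
    · rw [hQm _ (by omega), hg.mem k hk, Finset.sum_div]
      refine Finset.sum_congr rfl fun i hi => ?_
      rw [hQm i (by have := Finset.mem_range.1 hi; omega)]
      ring

/-! ## The program which computes the frame -/

/-- Write the current row of `[I | M]` to row `0` of array `4`, where `√d M` consists of random
signs. -/
def rowProg : Prog :=
  .seq (.loop 3 twoDim (.setCell 4 (.const 0) (.reg 3) (.const 0)))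
    (.seq (.setCell 4 (.const 0) (.reg 2) (.const 1))
      (.loop 3 (.reg 0) (.setCell 4 (.const 0) (.add (.reg 0) (.reg 3))
        (.div (.sub (.mul (.const 2) (.cell 0 (.const 0) (.add (.reg 5) (.reg 3)))) (.const 1))
          (.sqrt (.ofIdx (.reg 0)))))))

/-- Subtract from row `0` of array `4` its projection to the vector in the current column of
array `1`. -/
def projectProg : Prog :=
  .seq (sumProg 3 twoDim 5 (.const 0) (.const 0)
      (.mul (.cell 4 (.const 0) (.reg 3)) (.cell 1 (.reg 3) (.reg 4))))
    (.loop 3 twoDim (.setCell 4 (.const 0) (.reg 3)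
      (.sub (.cell 4 (.const 0) (.reg 3))
        (.mul (.cell 5 (.const 0) (.const 0)) (.cell 1 (.reg 3) (.reg 4))))))

/-- Store the normalized row `0` of array `4` in the current column of array `1`. -/
def normalizeProg : Prog :=
  .seq (sumProg 3 twoDim 5 (.const 0) (.const 0)
      (.mul (.cell 4 (.const 0) (.reg 3)) (.cell 4 (.const 0) (.reg 3))))
    (.loop 3 twoDim (.setCell 1 (.reg 3) (.reg 2)
      (.div (.cell 4 (.const 0) (.reg 3)) (.sqrt (.cell 5 (.const 0) (.const 0))))))

def prepareProg : Prog :=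
  .loop 2 (.reg 0) (.seq rowProg (.seq (.loop 4 (.reg 0) projectProg)
    (.seq normalizeProg (.setIdx 5 (.add (.reg 5) (.reg 0))))))

theorem isUniform_prepareProg : prepareProg.IsUniform := by
  simp [prepareProg, rowProg, projectProg, normalizeProg, sumProg, Prog.IsUniform, IExpr.IsDim,
    twoDim]

section

variable {d m : ℕ} {s : Store}

theorem run_rowProg (hd : s.idx 0 = d) (hm : s.idx 2 = m) :
    s.Agree {3} {q | q.1 = 4} (rowProg.run s) ∧
      (∀ j < d, (rowProg.run s).get (4, 0, j) = if j = m then 1 else 0) ∧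
      ∀ k < d, (rowProg.run s).get (4, 0, d + k) =
        (2 * s.get (0, 0, s.idx 5 + k) - 1) / Real.sqrt d := by
  obtain ⟨a1, b1⟩ := Prog.run_fill (k := 3) (e := twoDim) (s := s) (n := 2 * d)
    (p := .setCell 4 (.const 0) (.reg 3) (.const 0))
    (by rw [eval_twoDim, hd]) (R := {3}) (by simp) (fun j => (4, 0, j))
    (fun i i' hi => by simpa using hi) (fun _ => 0) fun κ _ t _ htk => by
      simp only [Prog.run, IExpr.eval_reg, IExpr.eval_const, htk]
      exact ⟨Store.agree_setCell (Set.mem_singleton _) _ _, by simp⟩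
  set s1 := (Prog.loop 3 twoDim (.setCell 4 (.const 0) (.reg 3) (.const 0))).run s with hs1
  have hm1 : s1.idx 2 = m := by rw [a1.idx 2 (by simp), hm]
  let s2 := s1.setCell 4 0 m 1
  have a12 : s.Agree {3} {q | q.1 = 4} s2 :=
    (a1.trans (Store.agree_setCell (R := ∅) (W := {(4, 0, m)}) rfl s1 1)).mono (by simp)
      (by simp [Set.subset_def])
  obtain ⟨a3, b3⟩ := Prog.run_fill (k := 3) (e := .reg 0) (s := s2) (n := d)
    (p := .setCell 4 (.const 0) (.add (.reg 0) (.reg 3))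
        (.div (.sub (.mul (.const 2) (.cell 0 (.const 0) (.add (.reg 5) (.reg 3)))) (.const 1))
          (.sqrt (.ofIdx (.reg 0)))))
    ((a12.idx 0 (by simp)).trans hd) (R := {3}) (by simp) (fun k => (4, 0, d + k))
    (fun i i' hi => by simpa using hi)
    (fun k => (2 * s.get (0, 0, s.idx 5 + k) - 1) / Real.sqrt d) fun κ _ t ht htk => by
      have h0 : t.idx 0 = d := by rw [ht.idx 0 (by simp), a12.idx 0 (by simp), hd]
      have h5 : t.idx 5 = s.idx 5 := by rw [ht.idx 5 (by simp), a12.idx 5 (by simp)]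
      simp only [Prog.run, IExpr.eval_reg, IExpr.eval_const, IExpr.eval_add, htk, h0]
      refine ⟨Store.agree_setCell (Set.mem_singleton _) _ _, ?_⟩
      simp only [Store.get_setCell, if_true, RExpr.eval_div, RExpr.eval_sub, RExpr.eval_mul,
        RExpr.eval_sqrt, RExpr.eval_ofIdx, RExpr.eval_cell, RExpr.eval_const, IExpr.eval_reg,
        IExpr.eval_const, IExpr.eval_add, htk, h0, h5]
      rw [ht.get _ (by simp), a12.get _ (by simp)]
      norm_num
  have hrun : rowProg.run s = (Prog.loop 3 (.reg 0) (.setCell 4 (.const 0)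
      (.add (.reg 0) (.reg 3))
        (.div (.sub (.mul (.const 2) (.cell 0 (.const 0) (.add (.reg 5) (.reg 3)))) (.const 1))
          (.sqrt (.ofIdx (.reg 0)))))).run s2 := by
    rw [rowProg, Prog.run, Prog.run, ← hs1, Prog.run]
    simp only [IExpr.eval_const, IExpr.eval_reg, hm1, RExpr.eval_const, Rat.cast_one, s2]
  rw [hrun]
  refine ⟨(a12.trans a3).mono (by simp) ?_, fun j hj => ?_, b3⟩
  · rintro q (hq | ⟨k, -, rfl⟩)
    exacts [hq, rfl]
  · rw [a3.get _ (by simp; omega)]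
    simp only [s2, Store.get_setCell, Prod.mk.injEq, true_and]
    rw [b1 j (by omega)]

theorem run_projectProg (hd : s.idx 0 = d) :
    s.Agree {3} {q | 4 ≤ q.1} (projectProg.run s) ∧
      ∀ j < 2 * d, (projectProg.run s).get (4, 0, j) = s.get (4, 0, j) -
        (∑ i ∈ Finset.range (2 * d), s.get (4, 0, i) * s.get (1, i, s.idx 4)) *
          s.get (1, j, s.idx 4) := by
  obtain ⟨a1, b1⟩ := run_sumProg (k := 3) (e := twoDim) (s := s) (n := 2 * d) (a := 5) (I := 0)
    (J := 0) (i := .const 0) (j := .const 0)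
    (x := .mul (.cell 4 (.const 0) (.reg 3)) (.cell 1 (.reg 3) (.reg 4)))
    (fun c => by rw [eval_twoDim, Store.idx_setCell, hd]) rfl rfl
    (fun i => s.get (4, 0, i) * s.get (1, i, s.idx 4)) fun κ _ t ht htk => by
      refine ⟨rfl, rfl, ?_⟩
      simp only [RExpr.eval_mul, RExpr.eval_cell, IExpr.eval_reg, IExpr.eval_const, htk,
        ht.idx 4 (by simp)]
      rw [ht.get _ (by simp), ht.get _ (by simp)]
  rw [projectProg, Prog.run]
  set s1 := (sumProg 3 twoDim 5 (.const 0) (.const 0)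
    (.mul (.cell 4 (.const 0) (.reg 3)) (.cell 1 (.reg 3) (.reg 4)))).run s
  obtain ⟨a2, b2⟩ := Prog.run_fill (k := 3) (e := twoDim) (s := s1) (n := 2 * d)
    (p := .setCell 4 (.const 0) (.reg 3)
      (.sub (.cell 4 (.const 0) (.reg 3))
        (.mul (.cell 5 (.const 0) (.const 0)) (.cell 1 (.reg 3) (.reg 4)))))
    (by rw [eval_twoDim, a1.idx 0 (by simp), hd]) (R := {3}) (by simp) (fun j => (4, 0, j))
    (fun i i' hi => by simpa using hi)
    (fun j => s.get (4, 0, j) -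
      (∑ i ∈ Finset.range (2 * d), s.get (4, 0, i) * s.get (1, i, s.idx 4)) *
          s.get (1, j, s.idx 4)) fun κ _ t ht htk => by
      have h4 : t.idx 4 = s.idx 4 := by rw [ht.idx 4 (by simp), a1.idx 4 (by simp)]
      simp only [Prog.run, IExpr.eval_reg, IExpr.eval_const, htk]
      refine ⟨Store.agree_setCell (Set.mem_singleton _) _ _, ?_⟩
      simp only [Store.get_setCell, if_true, RExpr.eval_sub, RExpr.eval_mul, RExpr.eval_cell,
        IExpr.eval_reg, IExpr.eval_const, htk, h4]
      rw [ht.get _ (by simp), ht.get _ (by simp), ht.get _ (by simp), a1.get _ (by simp), b1,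
        a1.get _ (by simp)]
  refine ⟨(a1.trans a2).mono (by simp) ?_, b2⟩
  rintro q (hq | ⟨k, -, rfl⟩)
  · rw [Set.mem_singleton_iff.1 hq]
    exact Nat.le_succ 4
  · exact Nat.le_refl 4

theorem run_normalizeProg (hd : s.idx 0 = d) (hm : s.idx 2 = m) :
    s.Agree {3} ({(5, 0, 0)} ∪ {q | q.1 = 1 ∧ q.2.2 = m}) (normalizeProg.run s) ∧
      ∀ j < 2 * d, (normalizeProg.run s).get (1, j, m) = s.get (4, 0, j) /
        Real.sqrt (∑ i ∈ Finset.range (2 * d), s.get (4, 0, i) * s.get (4, 0, i)) := by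
  obtain ⟨a1, b1⟩ := run_sumProg (k := 3) (e := twoDim) (s := s) (n := 2 * d) (a := 5) (I := 0)
    (J := 0) (i := .const 0) (j := .const 0)
    (x := .mul (.cell 4 (.const 0) (.reg 3)) (.cell 4 (.const 0) (.reg 3)))
    (fun c => by rw [eval_twoDim, Store.idx_setCell, hd]) rfl rfl
    (fun i => s.get (4, 0, i) * s.get (4, 0, i)) fun κ _ t ht htk => by
      refine ⟨rfl, rfl, ?_⟩
      simp only [RExpr.eval_mul, RExpr.eval_cell, IExpr.eval_reg, IExpr.eval_const, htk]
      rw [ht.get _ (by simp)]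
  rw [normalizeProg, Prog.run]
  set s1 := (sumProg 3 twoDim 5 (.const 0) (.const 0)
    (.mul (.cell 4 (.const 0) (.reg 3)) (.cell 4 (.const 0) (.reg 3)))).run s
  obtain ⟨a2, b2⟩ := Prog.run_fill (k := 3) (e := twoDim) (s := s1) (n := 2 * d)
    (p := .setCell 1 (.reg 3) (.reg 2)
      (.div (.cell 4 (.const 0) (.reg 3)) (.sqrt (.cell 5 (.const 0) (.const 0)))))
    (by rw [eval_twoDim, a1.idx 0 (by simp), hd]) (R := {3}) (by simp) (fun j => (1, j, m))
    (fun i i' hi => by simpa using hi)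
    (fun j => s.get (4, 0, j) /
        Real.sqrt (∑ i ∈ Finset.range (2 * d), s.get (4, 0, i) * s.get (4, 0, i)))
    fun κ _ t ht htk => by
      have h2 : t.idx 2 = m := by rw [ht.idx 2 (by simp), a1.idx 2 (by simp), hm]
      simp only [Prog.run, IExpr.eval_reg, htk, h2]
      refine ⟨Store.agree_setCell (Set.mem_singleton _) _ _, ?_⟩
      simp only [Store.get_setCell, if_true, RExpr.eval_div, RExpr.eval_sqrt, RExpr.eval_cell,
        IExpr.eval_reg, IExpr.eval_const, htk]
      rw [ht.get _ (by simp), ht.get _ (by simp), a1.get _ (by simp), b1]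
  refine ⟨(a1.trans a2).mono (by simp) ?_, b2⟩
  rintro q (hq | ⟨k, -, rfl⟩)
  · exact Or.inl hq
  · exact Or.inr ⟨rfl, rfl⟩

/-- The invariant of the main loop. -/
structure HoldsBasis (d m : ℕ) (c : ℕ → ℝ) (s : Store) : Prop where
  dim : s.idx 0 = d
  counter : s.idx 5 = m * d
  coins : ∀ n, s.get (0, 0, n) = c n
  basis : IsPartialBasis d m (fun i k => (2 * c (i * d + k) - 1) / Real.sqrt d)
    (fun l j => s.get (1, j, l))

theorem HoldsBasis.run_row {c : ℕ → ℝ} (h : HoldsBasis d m c s) (hm : s.idx 2 = m) (hmd : m < d) :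
    HoldsBasis d (m + 1) c ((Prog.seq rowProg (.seq (.loop 4 (.reg 0) projectProg)
      (.seq normalizeProg (.setIdx 5 (.add (.reg 5) (.reg 0)))))).run s) := by
  set M : ℕ → ℕ → ℝ := fun i k => (2 * c (i * d + k) - 1) / Real.sqrt d with hM
  obtain ⟨a1, b1, b1'⟩ := run_rowProg h.dim hm
  simp only [Prog.run]
  set s1 := rowProg.run s
  -- The raw row is `(e_m, M_m)`. Array `1` holds `Q` transposed, so its rows are the frame vectors.
  have w1 : IsWorkRow d m 0 M (fun l j => s.get (1, j, l)) fun j => s1.get (4, 0, j) := by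
    refine ⟨fun _ _ h => absurd h (Nat.not_lt_zero _), ?_, fun j hj hmj => ?_, fun k hk => ?_⟩
    · rw [b1 m hmd, if_pos rfl]
    · rw [b1 j hj, if_neg hmj.ne']
    · rw [b1' k hk, h.coins, h.counter, Finset.sum_eq_single m]
      · rw [b1 m hmd, if_pos rfl, one_mul]
      · intro i hi him
        rw [b1 i (Finset.mem_range.1 hi), if_neg him, zero_mul]
      · exact fun hi => absurd (Finset.mem_range.2 hmd) hi
  have hd1 : (IExpr.reg 0).eval s1 = d := (a1.idx 0 (by simp)).trans h.dim
  rw [hd1]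
  set s2 := loopState projectProg.run 4 s1 d with hs2
  obtain ⟨a2, w2⟩ : s1.Agree {3, 4} {q | 4 ≤ q.1} s2 ∧
      IsWorkRow d m d M (fun l j => s.get (1, j, l)) fun j => s2.get (4, 0, j) := by
    refine loopState_induction (fun l t => s1.Agree {3, 4} {q | 4 ≤ q.1} t ∧
      IsWorkRow d m l M (fun l j => s.get (1, j, l)) fun j => t.get (4, 0, j))
      ⟨Store.Agree.refl _ _ _, w1⟩ ?_
    rintro l hl t ⟨ht, hw⟩
    have ht' : s1.Agree {3, 4} {q | 4 ≤ q.1} (t.setIdx 4 l) :=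
      (ht.trans (Store.agree_setIdx (R := {4}) (W := ∅) rfl t l)).mono (by simp) (by simp)
    obtain ⟨a, b⟩ := run_projectProg ((ht'.idx 0 (by simp)).trans hd1)
    refine ⟨(ht'.trans a).mono (by simp) (by simp), hw.step h.basis hmd hl fun j hj => ?_⟩
    have h4 : (t.setIdx 4 l).idx 4 = l := by rw [Store.idx_setIdx, if_pos rfl]
    rw [b j hj, h4]
    have h1 : ∀ i, (t.setIdx 4 l).get (1, i, l) = s.get (1, i, l) := fun i => by
      rw [ht'.get _ (by simp), a1.get _ (by simp)]
    simp only [h1, Store.get_setIdx]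
  have a12 := a1.trans a2
  obtain ⟨a3, b3⟩ := run_normalizeProg (s := s2) (d := d) (m := m)
    ((a12.idx 0 (by simp)).trans h.dim) ((a12.idx 2 (by simp)).trans hm)
  set s3 := normalizeProg.run s2
  have a123 := a12.trans a3
  have h0 : s3.idx 0 = d := (a123.idx 0 (by simp)).trans h.dim
  have h5 : s3.idx 5 = m * d := (a123.idx 5 (by simp)).trans h.counter
  refine ⟨?_, ?_, fun n => ?_, ?_⟩
  · rw [Store.idx_setIdx, if_neg (by norm_num), h0]
  -- Register `5` maintains the offset `m * d` into the coins by repeated addition.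
  · rw [Store.idx_setIdx, if_pos rfl, IExpr.eval_add, IExpr.eval_reg, IExpr.eval_reg, h0, h5]
    ring
  · rw [Store.get_setIdx, a123.get _ (by simp), h.coins]
  · refine h.basis.succ hmd w2 (fun l hl j _ => ?_) fun j hj => ?_
    · simp only [Store.get_setIdx]
      rw [a123.get _ (by simp [hl])]
    · simp only [Store.get_setIdx]
      exact b3 j hj

theorem HoldsBasis.run_prepareProg {c : ℕ → ℝ} (h : HoldsBasis d 0 c s) :
    HoldsBasis d d c (prepareProg.run s) := by
  rw [prepareProg, Prog.run]
  have hd : (IExpr.reg 0).eval s = d := h.dim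
  rw [hd]
  refine loopState_induction (fun m t => HoldsBasis d m c t) h fun m hm t ht => ?_
  refine HoldsBasis.run_row ⟨?_, ?_, fun n => ht.coins n, ht.basis⟩ ?_ hm
  · rw [Store.idx_setIdx, if_neg (by norm_num), ht.dim]
  · rw [Store.idx_setIdx, if_neg (by norm_num), ht.counter]
  · rw [Store.idx_setIdx, if_pos rfl]

end

theorem holdsBasis_prepareInput (d : ℕ) {n : ℕ} (r : Fin n → Bool) :
    HoldsBasis d 0 (rowArray (fun i => if r i then 1 else 0) 0)
      (SQAlgorithm.prepareInput d r) where
  dim := rfl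
  counter := (zero_mul d).symm
  coins _ := rfl
  basis := ⟨fun _ h => absurd h (Nat.not_lt_zero _), fun _ _ _ _ _ => rfl,
    fun _ h => absurd h (Nat.not_lt_zero _), fun _ h => absurd h (Nat.not_lt_zero _)⟩

/-! ## The mean estimation algorithm -/

def meanEstimationAlgorithm : SQAlgorithm where
  prepare := prepareProg
  query := queryProg 2000 2000000 50000000
  decode := decodeProg 50000000

theorem queryFun_meanEstimationAlgorithm {d : ℕ} (u : Fin (2 * d) → Vec d) (j : Fin (2 * d))
    (w : Vec d) : meanEstimationAlgorithm.queryFun u j w =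
      Real.sqrt ((2 * d : ℕ) : ℝ) / 50000000 * kashinCoef 2000 u (2000000 * d) w j := by
  have h : meanEstimationAlgorithm.query = queryProg 2000 2000000 50000000 := rfl
  have h1 := run_queryProg u j w 2000 2000000 50000000
  rw [Store.get_mk, Nat.cast_ofNat] at h1
  rw [SQAlgorithm.queryFun, h, h1]

theorem estimate_meanEstimationAlgorithm {d : ℕ} (u : Fin (2 * d) → Vec d)
    (v : Fin (2 * d) → ℝ) : meanEstimationAlgorithm.estimate u v =
      ∑ i, (v i * (50000000 / Real.sqrt ((2 * d : ℕ) : ℝ))) • u i := by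
  ext l
  change ((decodeProg 50000000).run (SQAlgorithm.decodeInput u v)).get (3, 0, l) = _
  rw [run_decodeProg, Nat.cast_ofNat]
  simp

/-- Mean estimation from the coefficients of Kashin representations. -/
theorem solvesL2MeanEstimation_of_isKashinRepresentation {d N : ℕ} {u : Fin N → Vec d}
    (hN : 0 < N) (hu : IsTightFrame u) {K : ℝ} (hK : 0 < K) {a : Vec d → Fin N → ℝ}
    (ha : ∀ w, IsKashinRepresentation u K w (a w)) (hac : ∀ j, Continuous fun w => a w j)
    {ε : ℝ} (hε : 0 < ε) :
    SolvesL2MeanEstimation (fun j w => Real.sqrt N / K * a w j)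
      (fun v => ∑ j, (v j * (K / Real.sqrt N)) • u j) (ε / K) ε := by
  have hN' : (0 : ℝ) < N := mod_cast hN
  have hs : 0 < Real.sqrt N := Real.sqrt_pos.2 hN'
  refine ⟨fun j => ⟨((hac j).const_mul _).measurable, fun w hw => ?_⟩, ?_⟩
  · rw [Set.mem_Icc, ← abs_le, abs_mul, abs_of_nonneg (by positivity)]
    have h1 : ‖w‖ ≤ 1 := by simpa using hw
    calc Real.sqrt N / K * |a w j| ≤ Real.sqrt N / K * (K / Real.sqrt N * ‖w‖) := by
          gcongr
          exact (ha w).2 j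
      _ = ‖w‖ := by field_simp
      _ ≤ 1 := h1
  · intro P hP hball v hv
    have hnorm : ∀ᵐ w ∂P, ‖w‖ ≤ 1 := hball.mono fun w hw => by simpa using hw
    have hint : ∀ j, Integrable (fun w => a w j) P := by
      intro j
      refine Integrable.of_bound (hac j).aestronglyMeasurable (K / Real.sqrt N)
        (hnorm.mono fun w hw => ((ha w).2 j).trans ?_)
      exact mul_le_of_le_one_right (by positivity) hw
    have hmean : ∫ w, w ∂P = ∑ j, (∫ w, a w j ∂P) • u j := by
      calc ∫ w, w ∂P = ∫ w, ∑ j, a w j • u j ∂P := integral_congr_ae (ae_of_all _ fun w => (ha w).1)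
        _ = ∑ j, (∫ w, a w j ∂P) • u j := by
          rw [integral_finsetSum _ fun j _ => (hint j).smul_const (u j)]
          exact Finset.sum_congr rfl fun j _ => integral_smul_const _ _
    rw [hmean, ← Finset.sum_sub_distrib]
    simp only [← sub_smul]
    refine (hu.norm_sum_smul_le _).trans ?_
    -- Rescaling by `K / √N` turns the tolerance `ε / K` into `ε / √N`; the `N` squared errors then
    -- sum to at most `ε²`.
    have hcoef : ∀ j, ((∫ w, a w j ∂P) - v j * (K / Real.sqrt N)) ^ 2 ≤ ε ^ 2 / N := by
      intro j
      have h1 := hv j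
      rw [IsStatAnswer, integral_const_mul] at h1
      have h2 : (∫ w, a w j ∂P) - v j * (K / Real.sqrt N) =
          -(K / Real.sqrt N) * (v j - Real.sqrt N / K * ∫ w, a w j ∂P) := by
        field_simp
        ring
      have h3 : |(∫ w, a w j ∂P) - v j * (K / Real.sqrt N)| ≤ ε / Real.sqrt N := by
        rw [h2, abs_mul, abs_neg, abs_of_pos (by positivity)]
        calc _ ≤ K / Real.sqrt N * (ε / K) := by gcongr
          _ = ε / Real.sqrt N := by field_simp
      rw [← sq_abs]
      refine (pow_le_pow_left₀ (abs_nonneg _) h3 2).trans_eq ?_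
      rw [div_pow, Real.sq_sqrt hN'.le]
    rw [Real.sqrt_le_left hε.le]
    refine (Finset.sum_le_sum fun j _ => hcoef j).trans_eq ?_
    rw [Finset.sum_const, Finset.card_univ, Fintype.card_fin, nsmul_eq_mul]
    field_simp

/-! ### Choice of the constants and probability of success -/

/-- Logarithmically many rounds would suffice, but a multiple of `d` is directly available as a loop
bound. The factor `2000000` exceeds `2 * (2 * 689²)`, so the power is at most `exp (-2d)`. -/
theorem one_sub_pow_le_one_div_sqrt {d : ℕ} (hd : 0 < d) :
    (1 - 1 / (2 * 689 ^ 2) : ℝ) ^ (2000000 * d) ≤ 1 / Real.sqrt ((2 * d : ℕ) : ℝ) := by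
  have hd' : (0 : ℝ) < d := mod_cast hd
  have h1 : (1 - 1 / (2 * 689 ^ 2) : ℝ) ≤ Real.exp (-(1 / (2 * 689 ^ 2))) :=
    Real.one_sub_le_exp_neg _
  refine (pow_le_pow_left₀ (by norm_num) h1 _).trans ?_
  have h2 : (0 : ℝ) < 2 * d := by positivity
  have h3 : Real.sqrt (2 * d) ≤ Real.exp (2 * d) :=
    (Real.sqrt_le_left (Real.exp_pos _).le).2 (by
      have := Real.add_one_le_exp (2 * d : ℝ)
      nlinarith)
  rw [← Real.exp_nat_mul]
  push_cast
  calc Real.exp (2000000 * d * -(1 / (2 * 689 ^ 2))) ≤ Real.exp (-(2 * d)) := by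
        gcongr
        norm_num
        linarith
    _ = 1 / Real.exp (2 * d) := by rw [Real.exp_neg, one_div]
    _ ≤ 1 / Real.sqrt (2 * d) := by
        gcongr

theorem succeedsWith_of_hasUncertaintyPrinciple {d : ℕ} {u : Fin (2 * d) → Vec d}
    (hu : IsTightFrame u) (hup : HasUncertaintyPrinciple u 2000 (1 - 1 / (2 * 689 ^ 2))) :
    meanEstimationAlgorithm.SucceedsWith 50000000 u := by
  rcases Nat.eq_zero_or_pos d with rfl | hd
  · refine ⟨hu, ⟨fun _ _ => 0, fun w => ⟨Subsingleton.elim _ _, fun j => j.elim0⟩,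
      fun j => j.elim0⟩, fun ε hε => ⟨fun j => j.elim0, fun P _ _ v _ => ?_⟩⟩
    rw [Subsingleton.elim ((∫ w, w ∂P) - _) 0, norm_zero]
    exact hε.le
  -- The bound is `45 * 2 * 689² + 1`, about `4.3 * 10⁷`.
  have hK : Real.sqrt (2000 : ℕ) / (1 - (1 - 1 / (2 * 689 ^ 2))) + 1 ≤ 50000000 := by
    have h1 : Real.sqrt (2000 : ℕ) ≤ 45 := by
      rw [Real.sqrt_le_left (by norm_num)]
      norm_num
    rw [sub_sub_cancel, div_div_eq_mul_div, div_one]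
    linarith
  have ha : ∀ w, IsKashinRepresentation u 50000000 w (kashinCoef 2000 u (2000000 * d) w) :=
    isKashinRepresentation_kashinCoef (by omega) (by norm_num) (by norm_num) (by norm_num) hu hup
      (one_sub_pow_le_one_div_sqrt hd) hK
  refine ⟨hu, ⟨fun w => kashinCoef 2000 u (2000000 * d) w, ha, fun j w =>
    queryFun_meanEstimationAlgorithm u j w⟩, fun ε hε => ?_⟩
  have h := solvesL2MeanEstimation_of_isKashinRepresentation (by omega) hu
    (show (0 : ℝ) < 50000000 by norm_num) ha (fun j => continuous_kashinCoef _ j) hε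
  have h1 : meanEstimationAlgorithm.queryFun u = fun j w =>
      Real.sqrt ((2 * d : ℕ) : ℝ) / 50000000 * kashinCoef 2000 u (2000000 * d) w j :=
    funext fun j => funext fun w => queryFun_meanEstimationAlgorithm u j w
  have h2 : meanEstimationAlgorithm.estimate u = fun v =>
      ∑ i, (v i * (50000000 / Real.sqrt ((2 * d : ℕ) : ℝ))) • u i :=
    funext fun v => estimate_meanEstimationAlgorithm u v
  rw [h1, h2]
  exact h

/-- The coin flips, arranged as a matrix. -/
def coinMatrix {d : ℕ} (r : Fin (d * d) → Bool) (k i : Fin d) : Bool := r (finProdFinEquiv (i, k))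

theorem coinMatrix_injective {d : ℕ} : Function.Injective (coinMatrix (d := d)) := by
  intro r r' h
  funext n
  obtain ⟨⟨i, k⟩, rfl⟩ := finProdFinEquiv.surjective n
  exact congrFun (congrFun h k) i

/-- The final Gram–Schmidt invariant supplies both inputs of the uncertainty principle: orthonormal
rows, and the form `(p, Mᵀ p)` with `√d Mᵀ` the sign matrix `coinMatrix r`. -/
theorem succeedsWith_frame {d : ℕ} (r : Fin (d * d) → Bool)
    (hr : d < 1000 ∨ IsWellConditioned (coinMatrix r)) :
    meanEstimationAlgorithm.SucceedsWith 50000000 (meanEstimationAlgorithm.frame d r) := by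
  have h := (holdsBasis_prepareInput d r).run_prepareProg.basis
  have horth : ∀ l l' : Fin d, ∑ j, meanEstimationAlgorithm.frame d r j l *
      meanEstimationAlgorithm.frame d r j l' = if l = l' then 1 else 0 := by
    intro l l'
    have := h.orthonormal l l.2 l' l'.2
    rw [Finset.sum_range] at this
    simp only [Fin.ext_iff]
    exact this
  refine succeedsWith_of_hasUncertaintyPrinciple (isTightFrame_of_orthonormal_rows _ horth)
    (hasUncertaintyPrinciple_of_rows (coinMatrix r) hr _ horth fun l k => ?_)
  have := h.mem l l.2 k k.2
  rw [Finset.sum_range] at this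
  refine this.trans ?_
  rw [signSum, Finset.sum_div]
  refine Finset.sum_congr rfl fun i _ => ?_
  have hlt : (i : ℕ) * d + k < d * d := by
    have := (finProdFinEquiv (i, k)).2
    rw [finProdFinEquiv_apply_val, mul_comm, add_comm] at this
    exact this
  have hc : coinMatrix r k i = r ⟨i * d + k, hlt⟩ := by
    refine congrArg r (Fin.ext ?_)
    rw [finProdFinEquiv_apply_val, mul_comm, add_comm]
  have hrow : 2 * rowArray (fun i => if r i then (1 : ℝ) else 0) 0 (i * d + k) - 1 =
      boolSign (coinMatrix r k i) := by
    rw [hc, rowArray, dif_pos ⟨rfl, hlt⟩, boolSign]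
    split_ifs <;> norm_num
  rw [hrow, mul_div_assoc', mul_comm]
  rfl

theorem two_thirds_le_coinProb_succeedsWith {d : ℕ} :
    2 / 3 ≤ coinProb (d * d) fun r =>
      meanEstimationAlgorithm.SucceedsWith 50000000 (meanEstimationAlgorithm.frame d r) := by
  classical
  rw [coinProb, le_div_iff₀ (by positivity), Nat.card_eq_fintype_card, Fintype.card_subtype]
  set P : (Fin (d * d) → Bool) → Prop := fun r =>
    meanEstimationAlgorithm.SucceedsWith 50000000 (meanEstimationAlgorithm.frame d r)
  have hsplit : (Finset.univ.filter P).card + (Finset.univ.filter fun r => ¬ P r).card =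
      2 ^ (d * d) := by
    rw [Finset.card_filter_add_card_filter_not]
    simp
  have hbad : 3 * ((Finset.univ.filter fun r => ¬ P r).card : ℝ) ≤ 2 ^ (d * d) := by
    rcases lt_or_ge d 1000 with hd | hd
    · rw [Finset.filter_eq_empty_iff.2 fun r _ => not_not.2 (succeedsWith_frame r (Or.inl hd))]
      simp
    -- A bad coin sequence yields an ill-conditioned matrix, and distinct sequences yield distinct
    -- matrices.
    · have h1 : (Finset.univ.filter fun r => ¬ P r).card ≤ (Finset.univ.filter
          fun B : Fin d → Fin d → Bool => ¬ IsWellConditioned B).card := by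
        refine Finset.card_le_card_of_injOn coinMatrix (fun r hr => ?_)
          coinMatrix_injective.injOn
        refine Finset.mem_coe.2 (Finset.mem_filter.2 ⟨Finset.mem_univ _, fun h => ?_⟩)
        exact (Finset.mem_filter.1 hr).2 (succeedsWith_frame r (Or.inr h))
      have h2 := card_not_isWellConditioned_le hd
      rw [← pow_mul] at h2
      have h3 : ((Finset.univ.filter fun r => ¬ P r).card : ℝ) ≤ _ := Nat.cast_le.2 h1
      linarith
  have hsplit' : ((Finset.univ.filter P).card : ℝ) + (Finset.univ.filter fun r => ¬ P r).card =
      2 ^ (d * d) := mod_cast hsplit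
  linarith

theorem runsInTime_meanEstimationAlgorithm (d m : ℕ) :
    meanEstimationAlgorithm.RunsInTime d m
      ((meanEstimationAlgorithm.prepare.timeBound + meanEstimationAlgorithm.query.timeBound +
        meanEstimationAlgorithm.decode.timeBound).eval d) := by
  rw [Polynomial.eval_add, Polynomial.eval_add]
  have hp : meanEstimationAlgorithm.prepare.IsUniform := isUniform_prepareProg
  have hq : meanEstimationAlgorithm.query.IsUniform := isUniform_queryProg _ _ _
  have hd : meanEstimationAlgorithm.decode.IsUniform := isUniform_decodeProg _
  refine ⟨fun r => ?_, fun u j w => ?_, fun u v => ?_⟩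
  · exact (hp.steps_le (SQAlgorithm.prepareInput d r)).trans
      ((Nat.le_add_right _ _).trans (Nat.le_add_right _ _))
  · exact (hq.steps_le (SQAlgorithm.queryInput u j w)).trans
      ((Nat.le_add_left _ _).trans (Nat.le_add_right _ _))
  · exact (hd.steps_le (SQAlgorithm.decodeInput u v)).trans
      (Nat.le_add_left _ _)

theorem mainTheorem1 :
    ∃ (K C : ℝ) (A : SQAlgorithm) (coins time : Polynomial ℕ), 0 < K ∧
      (∀ ε : ℝ, 0 < ε → statEstimationComplexity (ε / K) ≤ C / ε ^ 2) ∧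
      ∀ d : ℕ,
        A.RunsInTime d (coins.eval d) (time.eval d) ∧
        (∃ u : Fin (2 * d) → Vec d, A.SucceedsWith K u) ∧
        2 / 3 ≤ coinProb (coins.eval d) (fun r => A.SucceedsWith K (A.frame d r)) := by
  refine ⟨50000000, 50000000 ^ 2, meanEstimationAlgorithm, Polynomial.X * Polynomial.X, _,
    by norm_num, fun ε hε => ?_, fun d => ⟨runsInTime_meanEstimationAlgorithm d _, ?_⟩⟩
  · rw [statEstimationComplexity, div_pow, one_div_div]
  · rw [Polynomial.eval_mul, Polynomial.eval_X]
    refine ⟨?_, two_thirds_le_coinProb_succeedsWith⟩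
    -- Existence by the probabilistic method: without a good sequence the probability would be `0`.
    by_contra! h
    have h1 := two_thirds_le_coinProb_succeedsWith (d := d)
    have h2 : IsEmpty {r : Fin (d * d) → Bool // meanEstimationAlgorithm.SucceedsWith 50000000
        (meanEstimationAlgorithm.frame d r)} := ⟨fun r => h _ r.2⟩
    rw [coinProb, Nat.card_of_isEmpty] at h1
    norm_num at h1
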